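/- **Proposition (Closed curves).** Let $\Gamma$ be a closed curve in the plane with a $C^3$ unit speed parameterization $\gamma:\mathbb R\to\mathbb R^2$ of minimal period $L$, curvature $\kappa$ and turning number $\xi\in\mathbb Z$. Assume that $\Gamma$ is non-degenerate, i.e. its vertices (the points $\gamma(s)$ with $\kappa'(s)=0$) are isolated. Let $\sigma_\gamma=(\kappa,\kappa')$ be the signature map and $S=\sigma_\gamma(\mathbb R)$ the signature. A point of a planar set is called simple if it has an open neighbourhood whose intersection with the set is homeomorphic to $\mathbb R$ or to a half-open interval, and a self-intersection point otherwise. Assume that the set $Q$ of self-intersection points of $S$ is finite and non-empty. The signature quiver has vertex set $Q$; its edges $S_1,\dots,S_N$ are the connected components of $S\setminus Q$. Every connected component of $\sigma_\gamma^{-1}(S_i)$ is an open interval $(a,b)$; the edge $S_i$ goes from $\sigma_\gamma(a)$ to $\sigma_\gamma(b)$, and its weight is $\omega_i=\int_a^b\kappa(s)\,ds$ (these do not depend on the chosen component). Words in the edges in which each edge ends where the next one begins are paths; a path is closed if moreover its last edge ends where its first edge begins. A word is periodic if it is of the form $u^k$ with $k>1$. Let $W=S_{i_1}\cdots S_{i_k}=w^m$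 be a closed path (it need not contain all edges), where $w$ is not periodic, $m>1$ and $\gcd(m,\xi)=1$, and let $\tilde\mu_i$ be the number of times $S_i$ occurs in $W$. For each $r$ choose a connected component $(a_r,b_r)$ of $\sigma_\gamma^{-1}(S_{i_r})$, put $c_r=\sum_{j\le r}(b_j-a_j)$, let $\kappa_W(s)=\kappa(s+a_r-c_{r-1})$ for $s\in[c_{r-1},c_r)$, and extend $\kappa_W$ to $\mathbb R$ with period $L_W=c_k$. Let $\Gamma_W$ be the curve parameterized by $$\gamma_W(s)=\Big(\int_0^s\cos\eta(\tau)\,d\tau,\ \int_0^s\sin\eta(\tau)\,d\tau\Big),\qquad \eta(s)=\int_0^s\kappa_W(\tau)\,d\tau .$$ If $\sum_{i=1}^N\tilde\mu_i\omega_i=2\pi\xi$, then: 1. $\gamma_W$ is a $C^3$ unit speed parameterization, with curvature $\kappa_W$ and minimal period $L_W$, of a closed curve $\Gamma_W$; 2. the turning number of $\Gamma_W$ (over $[0,L_W]$) is $\xi$; 3. the symmetry index of $\Gamma_W$ is $m$: there are exactly $m$ elements $g\in SE(2)$ for which there is $c\in\mathbb R$ with $g\cdot\gamma_W(s)=\gamma_W(s+c)$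 for all $s$; 4. the signature index of $\Gamma_W$ is $\min\{\tilde\mu_i : S_i \text{ occurs in } W\}$: this is the minimum, over the points $\zeta$ of the signature of $\Gamma_W$, of $\#\{s\in[0,L_W) : \sigma_{\gamma_W}(s)=\zeta\}$; 5. if $\Gamma_W$ is simple (all its points are simple), then the indices of the oriented set $\Gamma_W$ have the same values: exactly $m$ elements $g\in SE(2)$ satisfy $g\cdot\Gamma_W=\Gamma_W$ as oriented curves, and $\min_{p\in\Gamma_W}\#\sigma_{\Gamma_W}^{-1}(\sigma_{\Gamma_W}(p))=\min\{\tilde\mu_i : S_i\text{ occurs in }W\}$, where $\sigma_{\Gamma_W}(\gamma_W(s))=\sigma_{\gamma_W}(s)$. -/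

import Mathlib

open Set Topology

noncomputable section

namespace SigCurve

/-! The Euclidean plane is `ℂ`; a curve is given by a parameterization `γ : ℝ → ℂ`,
and the signature lives in `ℝ × ℝ`. -/

/-- A point `p` of a planar set `Γ` is simple if some open set containing `p` meets `Γ` in a set
homeomorphic to `ℝ` or to a half-open interval. -/
def IsSimplePoint {X : Type*} [TopologicalSpace X] (Γ : Set X) (p : X) : Prop :=
  ∃ U : Set X, IsOpen U ∧ p ∈ U ∧
    (Nonempty (↥(Γ ∩ U) ≃ₜ ℝ) ∨ Nonempty (↥(Γ ∩ U) ≃ₜ ↥(Ico (0 : ℝ) 1)))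

/-- The set of self-intersection points of `Γ`: the points of `Γ` that are not simple. -/
def selfIntersections {X : Type*} [TopologicalSpace X] (Γ : Set X) : Set X :=
  {p | p ∈ Γ ∧ ¬ IsSimplePoint Γ p}

/-- `Γ` is simple if all its points are simple. -/
def IsSimple {X : Type*} [TopologicalSpace X] (Γ : Set X) : Prop :=
  ∀ p ∈ Γ, IsSimplePoint Γ p

/-- `γ` is a unit speed `C³` parameterization, with minimal period `L`, of a closed curve. -/
structure IsClosedCurve (γ : ℝ → ℂ) (L : ℝ) : Prop where
  contDiff : ContDiff ℝ 3 γ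
  unit_speed : ∀ s, ‖deriv γ s‖ = 1
  minimal_period : IsLeast {p : ℝ | 0 < p ∧ Function.Periodic γ p} L

/-- The signed Euclidean curvature `det (γ', γ'') / |γ'|³`. -/
def curvature (γ : ℝ → ℂ) (t : ℝ) : ℝ :=
  ((deriv γ t).re * (deriv (deriv γ) t).im - (deriv γ t).im * (deriv (deriv γ) t).re)
    / ‖deriv γ t‖ ^ 3

/-- The derivative of the curvature with respect to arc-length. -/
def curvatureDot (γ : ℝ → ℂ) (t : ℝ) : ℝ :=
  deriv (curvature γ) t / ‖deriv γ t‖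

/-- The parameterized signature map `σ_γ = (κ, κ̇)`. -/
def signatureMap (γ : ℝ → ℂ) (t : ℝ) : ℝ × ℝ := (curvature γ t, curvatureDot γ t)

/-- The set of vertices of the curve (points at which `κ̇` vanishes). -/
def curveVertices (γ : ℝ → ℂ) : Set ℂ := γ '' {t | curvatureDot γ t = 0}

/-- A curve is non-degenerate if all its vertices are isolated. -/
def IsNondegenerate (γ : ℝ → ℂ) : Prop :=
  ∀ p ∈ curveVertices γ, ∃ U ∈ 𝓝 p, curveVertices γ ∩ U = {p}

/-- `ξ` is the turning number of `γ` over `[0, L]`: a continuous angle function of the tangent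
increases by `2πξ`. -/
def HasTurningNumber (γ : ℝ → ℂ) (L : ℝ) (ξ : ℤ) : Prop :=
  ∃ θ : ℝ → ℝ, Continuous θ ∧
    (∀ s, deriv γ s = (‖deriv γ s‖ : ℂ) * Complex.exp ((θ s : ℂ) * Complex.I)) ∧
    θ L - θ 0 = 2 * Real.pi * ξ

/-! ### Symmetry and signature indices

An element of `SE(2)` is a pair `(u, v)` acting by `z ↦ u z + v`, where `|u| = 1`. -/

/-- The action of `SE(2)` on the plane. -/
def se2Act (g : Circle × ℂ) (z : ℂ) : ℂ := (g.1 : ℂ) * z + g.2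

/-- The symmetry index of the oriented set `Γ = range γ` (used for simple `Γ`): the number of
`g ∈ SE(2)` with `g · Γ = Γ`, as sets and as oriented curves. The orientation is recorded by the
set of pairs (point, tangent vector), on which `g` acts by `(p, v) ↦ (g p, u v)`. -/
def symIndex (γ : ℝ → ℂ) : ℕ∞ :=
  {g : Circle × ℂ |
    se2Act g '' range γ = range γ ∧
    (fun x : ℂ × ℂ => (se2Act g x.1, (g.1 : ℂ) * x.2)) '' range (fun s => (γ s, deriv γ s))
      = range (fun s => (γ s, deriv γ s))}.encard

/-- The symmetry index of a unit speed parameterized curve, simple or not: the number of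
`g ∈ SE(2)` that carry the parameterized curve to itself up to a shift of the parameter. -/
def paramSymIndex (γ : ℝ → ℂ) : ℕ∞ :=
  {g : Circle × ℂ | ∃ c : ℝ, ∀ s, se2Act g (γ s) = γ (s + c)}.encard

/-- The signature index of `Γ = range γ` (used for simple `Γ`): the minimum over the points
`p = γ t` of `Γ` of the number of points of `Γ` with the same value of the signature map. -/
def sigIndex (γ : ℝ → ℂ) : ℕ∞ :=
  ⨅ t : ℝ, (γ '' {u | signatureMap γ u = signatureMap γ t}).encard

/-- The signature index of a parameterized closed curve of period `L`, simple or not: the minimum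
over the signature points `ζ` of the number of parameters in `[0, L)` that are mapped to `ζ`. -/
def paramSigIndex (γ : ℝ → ℂ) (L : ℝ) : ℕ∞ :=
  ⨅ ζ ∈ range (signatureMap γ), {u | u ∈ Ico 0 L ∧ signatureMap γ u = ζ}.encard

/-! ### The quiver of a parameterized closed curve `σ` -/

/-- An edge of the quiver of `S`: a connected component of `S` with its self-intersection points
removed. -/
def QuiverEdge (S : Set (ℝ × ℝ)) : Type :=
  {E : Set (ℝ × ℝ) // ∃ ζ ∈ S \ selfIntersections S,
    E = connectedComponentIn (S \ selfIntersections S) ζ}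

/-- `(a, b)` is one of the parameter intervals that trace the edge `E`, that is, a connected
component of `σ⁻¹(E)`. -/
def IsEdgeArc (σ : ℝ → ℝ × ℝ) (E : QuiverEdge (range σ)) (a b : ℝ) : Prop :=
  ∃ t ∈ σ ⁻¹' E.1, connectedComponentIn (σ ⁻¹' E.1) t = Ioo a b

/-- `q` is the beginning vertex of the edge `E`. -/
def IsBeginning (σ : ℝ → ℝ × ℝ) (E : QuiverEdge (range σ)) (q : ℝ × ℝ) : Prop :=
  ∃ a b, IsEdgeArc σ E a b ∧ σ a = q

/-- `q` is the ending vertex of the edge `E`. -/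
def IsEnding (σ : ℝ → ℝ × ℝ) (E : QuiverEdge (range σ)) (q : ℝ × ℝ) : Prop :=
  ∃ a b, IsEdgeArc σ E a b ∧ σ b = q

/-- The edge `F` may follow the edge `E`. -/
def Follows (σ : ℝ → ℝ × ℝ) (E F : QuiverEdge (range σ)) : Prop :=
  ∃ q, IsEnding σ E q ∧ IsBeginning σ F q

/-- A closed path: each edge is followed by the next one, and the last edge by the first one. -/
def IsClosedPath (σ : ℝ → ℝ × ℝ) (W : List (QuiverEdge (range σ))) : Prop :=
  W.IsChain (Follows σ) ∧ ∃ h : W ≠ [], Follows σ (W.getLast h) (W.head h)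

/-- The word `w ^ m`. -/
def wordPow {α : Type*} (w : List α) (m : ℕ) : List α := (List.replicate m w).flatten

/-- A word is periodic if it is a power `u ^ k` with `k > 1`. -/
def IsPeriodicWord {α : Type*} (w : List α) : Prop :=
  ∃ (u : List α) (k : ℕ), 1 < k ∧ w = wordPow u k

/-- The multiplicity of an edge in a word. -/
def multiplicity {α : Type*} (W : List α) (E : α) : ℕ :=
  letI := Classical.decEq α
  W.count E

/-- `x` is the weight of the edge `E` of the signature quiver of `γ`: the integral of the curvature
over one of the parameter intervals that trace `E`. -/
def IsWeight (γ : ℝ → ℂ) (E : QuiverEdge (range (signatureMap γ))) (x : ℝ) : Prop :=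
  ∃ a b, IsEdgeArc (signatureMap γ) E a b ∧ x = ∫ s in a..b, curvature γ s

/-! ### The curve induced by a path -/

/-- The total length of a list of intervals `(a_r, b_r)`. -/
def totalLength (I : List (ℝ × ℝ)) : ℝ := (I.map fun p => p.2 - p.1).sum

/-- The concatenation of the restrictions of `κ` to the intervals `(a_r, b_r)` of the list: with
`c_r = ∑_{j ≤ r} (b_j - a_j)`, its value at `s ∈ [c_{r-1}, c_r)` is `κ (s + a_r - c_{r-1})`. -/
def concatenate (κ : ℝ → ℝ) : List (ℝ × ℝ) → ℝ → ℝ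
  | [], _ => 0
  | p :: I, s => if s < p.2 - p.1 then κ (s + p.1) else concatenate κ I (s - (p.2 - p.1))

/-- The reshuffled curvature `κ_W`: the concatenation, extended from `[0, c_k)` to `ℝ` with
period `c_k`. -/
def reshuffle (κ : ℝ → ℝ) (I : List (ℝ × ℝ)) (s : ℝ) : ℝ :=
  concatenate κ I (s - totalLength I * ⌊s / totalLength I⌋)

/-- The unit speed curve with curvature function `κ`, starting at `0` with tangent vector `1`:
`γ(s) = ∫₀ˢ (cos η, sin η)`, where `η(s) = ∫₀ˢ κ`. -/
def curveOfCurvature (κ : ℝ → ℝ) (s : ℝ) : ℂ :=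
  ∫ τ in (0 : ℝ)..s, Complex.exp (((∫ x in (0 : ℝ)..τ, κ x : ℝ) : ℂ) * Complex.I)

end SigCurve

end

open SigCurve

/-! The signature is rigid away from its self-intersections. Since the zeros of `κ'` are isolated,
the signature map is locally injective. If two parameters lie over the same simple point of `S`, one
branch is a continuous reparametrization `φ` of the other. Differentiating `κ ∘ φ = κ` and using `κ'
∘ φ = κ'` gives `φ' = 1` off the zeros of `κ'`, so `φ` is a translation
(`IsSignaturePair.eventually_eq_shift`). By connectedness, all arcs that trace an edge are
translates of one another and each traces the edge once. Lengths, weights and end vertices therefore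
depend only on the edge (`IsEdgeArc.eq_shift`).

Consecutive arcs of a closed path agree in `κ` and in `κ'` where they meet, so `κW` is `C¹`
(`IsArcChain.exists_derivative`). Its breakpoints are exactly the parameters over non-simple points
of `S`. Hence a period of `κW` permutes the breakpoints and induces a period of the bi-infinite word
(`IsArcChain.exists_period`). As `w` is not a proper power, the periods of `κW` are the multiples of
`ℓ`, the total length of the arcs of `w`, and `L_W = m ℓ`.

A shift by a period of `κW` acts on the curve as a rigid motion. Over `ℓ` the tangent turns by
`2πξ/m`, so by coprimality the shift by `k ℓ` has trivial rotation part iff `m ∣ k`. The shift by `m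
ℓ` is a translation that commutes with a nontrivial rotation about some centre, so it is the
identity and the curve closes up. The shifts by `k ℓ` modulo `m ℓ` are all the symmetries.

Over an interior point of an edge, `κW` has one parameter per occurrence of the edge in `W`, and
over a vertex at least as many as for any edge of `W` that begins there; this gives the signature
index. On a simple curve, position and velocity at one parameter determine a unit speed
parametrization (`IsUnitSpeed.eq_shift`), so the indices of the oriented set reduce to those of the
parametrization. -/

namespace SigCurve

/-! ### Local reparametrization near a simple point -/

section Reparametrization

variable {X : Type*} [TopologicalSpace X] {Γ : Set X} {p : X}

lemma IsSimplePoint.exists_chart (hp : IsSimplePoint Γ p) :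
    ∃ U : Set X, IsOpen U ∧ p ∈ U ∧ ∃ H : X → ℝ, ContinuousOn H (Γ ∩ U) ∧ InjOn H (Γ ∩ U) := by
  classical
  obtain ⟨U, hU, hpU, h⟩ := hp
  refine ⟨U, hU, hpU, ?_⟩
  have key : ∃ h : ↥(Γ ∩ U) → ℝ, Continuous h ∧ Function.Injective h := by
    rcases h with ⟨⟨e⟩⟩ | ⟨⟨e⟩⟩
    · exact ⟨e, e.continuous, e.injective⟩
    · exact ⟨fun x => (e x : ℝ), continuous_subtype_val.comp e.continuous,
        Subtype.val_injective.comp e.injective⟩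
  obtain ⟨h, hc, hi⟩ := key
  have hres : (Γ ∩ U).domRestrict (fun x => if hx : x ∈ Γ ∩ U then h ⟨x, hx⟩ else 0) = h := by
    funext x
    exact dif_pos x.2
  refine ⟨fun x => if hx : x ∈ Γ ∩ U then h ⟨x, hx⟩ else 0, ?_, ?_⟩
  · rw [continuousOn_iff_continuous_domRestrict, hres]
    exact hc
  · rw [injOn_iff_injective, hres]
    exact hi

lemma image_Icc_mem_nhds {f : ℝ → ℝ} {t δ : ℝ} (hδ : 0 < δ)
    (hf : ContinuousOn f (Icc (t - δ) (t + δ))) (hi : InjOn f (Icc (t - δ) (t + δ))) :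
    f '' Icc (t - δ) (t + δ) ∈ 𝓝 (f t) := by
  have hle : t - δ ≤ t + δ := by linarith
  have h0 : t - δ ∈ Icc (t - δ) (t + δ) := ⟨le_rfl, hle⟩
  have h1 : t ∈ Icc (t - δ) (t + δ) := ⟨by linarith, by linarith⟩
  have h2 : t + δ ∈ Icc (t - δ) (t + δ) := ⟨hle, le_rfl⟩
  rcases hf.strictMonoOn_of_injOn_Icc' hle hi with hm | hm
  · exact Filter.mem_of_superset (Icc_mem_nhds (hm h0 h1 (by linarith)) (hm h1 h2 (by linarith)))
      (intermediate_value_Icc hle hf)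
  · exact Filter.mem_of_superset (Icc_mem_nhds (hm h1 h2 (by linarith)) (hm h0 h1 (by linarith)))
      (intermediate_value_Icc' hle hf)

/-- In a chart, `β` becomes an injective continuous real function, hence a strictly monotone one
whose image is a neighbourhood; injectivity of the chart carries this back to `Γ`. Only continuity
and injectivity of the chart matter, so both models of a simple point are treated alike. -/
lemma image_Icc_mem_nhdsWithin {β : ℝ → X} (hβ : Continuous β) (hβΓ : ∀ s, β s ∈ Γ) {t δ : ℝ}
    (hδ : 0 < δ) (hi : InjOn β (Icc (t - δ) (t + δ))) (hp : IsSimplePoint Γ (β t)) :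
    β '' Icc (t - δ) (t + δ) ∈ 𝓝[Γ] (β t) := by
  obtain ⟨U, hU, hpU, H, hHc, hHi⟩ := hp.exists_chart
  obtain ⟨ε, hε, hεU⟩ := Metric.mem_nhds_iff.1 ((hU.preimage hβ).mem_nhds hpU)
  set d := min δ (ε / 2) with hd
  have hd0 : 0 < d := lt_min hδ (by linarith)
  have hsub : Icc (t - d) (t + d) ⊆ Icc (t - δ) (t + δ) := by
    have : d ≤ δ := min_le_left _ _
    exact Icc_subset_Icc (by linarith) (by linarith)
  have hmaps : MapsTo β (Icc (t - d) (t + d)) (Γ ∩ U) := by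
    intro s hs
    refine ⟨hβΓ s, hεU ?_⟩
    have : d ≤ ε / 2 := min_le_right _ _
    rw [Metric.mem_ball, Real.dist_eq, abs_lt]
    constructor <;> linarith [hs.1, hs.2]
  have hn := image_Icc_mem_nhds hd0 (hHc.comp hβ.continuousOn hmaps)
    (hHi.comp (hi.mono hsub) hmaps)
  have hpre : Γ ∩ U ∩ H ⁻¹' ((H ∘ β) '' Icc (t - d) (t + d)) ∈ 𝓝[Γ ∩ U] (β t) :=
    Filter.inter_mem self_mem_nhdsWithin (hHc (β t) ⟨hβΓ t, hpU⟩ hn)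
  rw [nhdsWithin_inter_of_mem' (mem_nhdsWithin_of_mem_nhds (hU.mem_nhds hpU))] at hpre
  refine Filter.mem_of_superset hpre ?_
  rintro x ⟨hx, s, hs, hsx⟩
  exact ⟨s, hsub hs, hHi (hmaps hs) hx hsx⟩

/-- Near `t` the curve `α` stays in the image of `β` by `image_Icc_mem_nhdsWithin`, and `φ` is `α`
followed by the inverse of `β`. Continuity holds because `β` embeds the compact interval. -/
lemma exists_local_reparametrization [T2Space X] {α β : ℝ → X} (hα : Continuous α)
    (hαΓ : ∀ s, α s ∈ Γ) (hβ : Continuous β) (hβΓ : ∀ s, β s ∈ Γ) {t t' δ : ℝ} (hδ : 0 < δ)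
    (hi : InjOn β (Icc (t' - δ) (t' + δ))) (hp : IsSimplePoint Γ (β t')) (htt : α t = β t') :
    ∃ φ : ℝ → ℝ, ∃ ε > 0, φ t = t' ∧ ContinuousOn φ (Ioo (t - ε) (t + ε)) ∧
      ∀ s ∈ Ioo (t - ε) (t + ε), φ s ∈ Icc (t' - δ) (t' + δ) ∧ β (φ s) = α s := by
  have hn := image_Icc_mem_nhdsWithin hβ hβΓ hδ hi hp
  rw [← htt] at hn
  have hev : ∀ᶠ s in 𝓝 t, α s ∈ β '' Icc (t' - δ) (t' + δ) :=
    (tendsto_nhdsWithin_of_tendsto_nhds_of_eventually_within _ hα.continuousAt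
      (Filter.Eventually.of_forall hαΓ)) hn
  obtain ⟨ε, hε, hball⟩ := Metric.mem_nhds_iff.1 hev
  rw [Real.ball_eq_Ioo] at hball
  have hsp := fun s (hs : s ∈ Ioo (t - ε) (t + ε)) =>
    Function.invFunOn_pos (hball hs)
  refine ⟨Function.invFunOn β (Icc (t' - δ) (t' + δ)) ∘ α, ε, hε, ?_, ?_, fun s hs => hsp s hs⟩
  · have h1 := hsp t ⟨by linarith, by linarith⟩
    exact hi h1.1 ⟨by linarith, by linarith⟩ (h1.2.trans htt)
  · have hemb : IsClosedEmbedding ((Icc (t' - δ) (t' + δ)).domRestrict β) :=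
      Continuous.isClosedEmbedding (hβ.comp continuous_subtype_val) (injOn_iff_injective.1 hi)
    rw [continuousOn_iff_continuous_domRestrict]
    have hc : Continuous (fun s : Ioo (t - ε) (t + ε) =>
        (⟨Function.invFunOn β (Icc (t' - δ) (t' + δ)) (α s), (hsp s s.2).1⟩ :
          Icc (t' - δ) (t' + δ))) := by
      rw [hemb.isEmbedding.continuous_iff]
      have : (Icc (t' - δ) (t' + δ)).domRestrict β ∘ (fun s : Ioo (t - ε) (t + ε) =>
        (⟨Function.invFunOn β (Icc (t' - δ) (t' + δ)) (α s), (hsp s s.2).1⟩ :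
          Icc (t' - δ) (t' + δ))) = fun s : Ioo (t - ε) (t + ε) => α (s : ℝ) := by
        funext s
        exact (hsp s s.2).2
      rw [this]
      exact hα.comp continuous_subtype_val
    exact continuous_subtype_val.comp hc

end Reparametrization

/-- A priori `φ` is only continuous, so the chain rule is not available. The slope of `φ` is instead
the slope of `g` divided by `dslope f`, which stays defined when `φ x = φ s` and tends to `f' ≠ 0`.
-/
lemma hasDerivAt_of_comp_eq {f g φ : ℝ → ℝ} {s f' g' : ℝ} (hφ : ContinuousAt φ s)
    (hf : HasDerivAt f f' (φ s)) (hf' : f' ≠ 0) (hg : HasDerivAt g g' s)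
    (h : ∀ᶠ x in 𝓝 s, f (φ x) = g x) : HasDerivAt φ (g' / f') s := by
  have hc : ContinuousAt (dslope f (φ s)) (φ s) :=
    continuousAt_dslope_same.2 hf.differentiableAt
  have h1 : Filter.Tendsto (fun x => dslope f (φ s) (φ x)) (𝓝 s) (𝓝 f') := by
    have := hc.tendsto.comp hφ.tendsto
    rwa [dslope_same, hf.deriv] at this
  rw [hasDerivAt_iff_tendsto_slope] at hg ⊢
  refine (hg.div (h1.mono_left nhdsWithin_le_nhds) hf').congr' ?_
  have hne : ∀ᶠ x in 𝓝 s, dslope f (φ s) (φ x) ≠ 0 := h1.eventually_ne hf'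
  filter_upwards [nhdsWithin_le_nhds h, nhdsWithin_le_nhds hne, self_mem_nhdsWithin]
    with x hx hx0 hxs
  have hxs' : x - s ≠ 0 := sub_ne_zero.2 hxs
  have h2 := sub_smul_dslope f (φ s) (φ x)
  rw [h.self_of_nhds, hx, smul_eq_mul] at h2
  rw [Pi.div_apply, div_eq_iff hx0, slope_def_field, slope_def_field, ← h2]
  ring

/-- A real function `κ` with continuous derivative `κ'`, whose zeros are isolated. -/
structure IsSignaturePair (κ κ' : ℝ → ℝ) : Prop where
  hasDerivAt : ∀ t, HasDerivAt κ (κ' t) t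
  continuous_deriv : Continuous κ'
  isolated : ∀ t, ∀ᶠ s in 𝓝[≠] t, κ' s ≠ 0

/-- The signature map of the pair `(κ, κ')`. -/
def sigPair (κ κ' : ℝ → ℝ) (t : ℝ) : ℝ × ℝ := (κ t, κ' t)

/-! ### Local injectivity and rigidity of the signature map -/

section LocalStructure

variable {κ κ' : ℝ → ℝ}

lemma IsSignaturePair.continuous (h : IsSignaturePair κ κ') : Continuous κ :=
  continuous_iff_continuousAt.2 fun t => (h.hasDerivAt t).continuousAt

lemma IsSignaturePair.continuous_sigPair (h : IsSignaturePair κ κ') :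
    Continuous (sigPair κ κ') := h.continuous.prodMk h.continuous_deriv

lemma IsSignaturePair.exists_ne_zero (h : IsSignaturePair κ κ') (t : ℝ) :
    ∃ δ > 0, ∀ s, |s - t| ≤ δ → s ≠ t → κ' s ≠ 0 := by
  obtain ⟨ε, hε, hb⟩ := Metric.mem_nhdsWithin_iff.1 (h.isolated t)
  refine ⟨ε / 2, by linarith, fun s hs hst => hb ⟨?_, hst⟩⟩
  rw [Metric.mem_ball, Real.dist_eq]
  linarith

lemma IsSignaturePair.exists_slope (h : IsSignaturePair κ κ') {x y : ℝ} (hxy : x < y) :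
    ∃ z ∈ Ioo x y, κ y - κ x = κ' z * (y - x) := by
  obtain ⟨z, hz, hz'⟩ := exists_hasDerivAt_eq_slope κ κ' hxy h.continuous.continuousOn
    fun z _ => h.hasDerivAt z
  refine ⟨z, hz, ?_⟩
  rw [hz', div_mul_cancel₀ _ (by linarith)]

lemma mul_pos_of_forall_ne_zero {f : ℝ → ℝ} {x y : ℝ} {s : Set ℝ} (hf : ContinuousOn f s)
    (hs : s.OrdConnected) (h0 : ∀ z ∈ s, f z ≠ 0) (hx : x ∈ s) (hy : y ∈ s) : 0 < f x * f y := by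
  by_contra! hneg
  obtain ⟨z, hz, hz0⟩ : ∃ z ∈ s, f z = 0 := by
    have hpc := hs.isPreconnected
    rcases le_total (f x) 0 with hx0 | hx0 <;> rcases le_total (f y) 0 with hy0 | hy0
    · exfalso
      have := mul_pos_of_neg_of_neg (lt_of_le_of_ne hx0 (h0 x hx)) (lt_of_le_of_ne hy0 (h0 y hy))
      linarith
    · exact hpc.intermediate_value hx hy hf ⟨hx0, hy0⟩
    · exact hpc.intermediate_value hy hx hf ⟨hy0, hx0⟩
    · exfalso
      have := mul_pos (lt_of_le_of_ne hx0 (h0 x hx).symm) (lt_of_le_of_ne hy0 (h0 y hy).symm)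
      linarith
  exact h0 z hz hz0

/-- If `x < y` have the same image, Rolle's theorem puts a zero of `κ'` between them, which can only
be `t`. On each side of `t` the sign of `κ'` is constant, and the two signs agree because `κ' x = κ'
y`. Then `κ` moves in the same direction on both sides, against `κ x = κ y`. -/
lemma IsSignaturePair.injOn_of_ne_zero (h : IsSignaturePair κ κ') {t δ : ℝ}
    (hδ : ∀ s, |s - t| ≤ δ → s ≠ t → κ' s ≠ 0) :
    InjOn (sigPair κ κ') (Icc (t - δ) (t + δ)) := by
  have key : ∀ x ∈ Icc (t - δ) (t + δ), ∀ y ∈ Icc (t - δ) (t + δ), x < y →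
      sigPair κ κ' x ≠ sigPair κ κ' y := by
    intro x hx y hy hxy heq
    have h1 : κ x = κ y := congrArg Prod.fst heq
    have h2 : κ' x = κ' y := congrArg Prod.snd heq
    have hmem : ∀ z ∈ Icc (t - δ) (t + δ), |z - t| ≤ δ := fun z hz =>
      abs_le.2 ⟨by linarith [hz.1], by linarith [hz.2]⟩
    have htxy : t ∈ Ioo x y := by
      obtain ⟨z, hz, hz'⟩ := h.exists_slope hxy
      have hz0 : κ' z = 0 := by
        rw [h1, sub_self, eq_comm, mul_eq_zero] at hz'
        exact hz'.resolve_right (by linarith)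
      by_contra htn
      refine hδ z (hmem z ⟨by linarith [hx.1, hz.1], by linarith [hy.2, hz.2]⟩) ?_ hz0
      rintro rfl
      exact htn hz
    obtain ⟨z, hz, hz'⟩ := h.exists_slope htxy.1
    obtain ⟨u, hu, hu'⟩ := h.exists_slope htxy.2
    have hl := mul_pos_of_forall_ne_zero (s := Ico x t) h.continuous_deriv.continuousOn ordConnected_Ico
      (fun w hw => hδ w (hmem w ⟨by linarith [hw.1, hx.1], by linarith [hw.2, htxy.2, hy.2]⟩)
        hw.2.ne) (left_mem_Ico.2 htxy.1) (Ioo_subset_Ico_self hz)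
    have hr := mul_pos_of_forall_ne_zero (s := Ioc t y) h.continuous_deriv.continuousOn ordConnected_Ioc
      (fun w hw => hδ w (hmem w ⟨by linarith [hw.1, hx.1, htxy.1], by linarith [hw.2, hy.2]⟩)
        hw.1.ne') (right_mem_Ioc.2 htxy.2) (Ioo_subset_Ioc_self hu)
    rw [h2] at hl
    have h3 : κ' y * (κ' z * (t - x)) + κ' y * (κ' u * (y - t)) = 0 := by
      rw [← hz', ← hu', h1]; ring
    have h4 := mul_pos hl (sub_pos.2 htxy.1)
    have h5 := mul_pos hr (sub_pos.2 htxy.2)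
    nlinarith
  intro x hx y hy heq
  rcases lt_trichotomy x y with hxy | hxy | hxy
  · exact absurd heq (key x hx y hy hxy)
  · exact hxy
  · exact absurd heq.symm (key y hy x hx hxy)

lemma IsSignaturePair.exists_injOn (h : IsSignaturePair κ κ') (t : ℝ) :
    ∃ δ > 0, InjOn (sigPair κ κ') (Icc (t - δ) (t + δ)) := by
  obtain ⟨δ, hδ, hne⟩ := h.exists_ne_zero t
  exact ⟨δ, hδ, h.injOn_of_ne_zero hne⟩

/-- Near a simple point of its image, the signature map is determined up to a shift of the
parameter. -/
lemma IsSignaturePair.eventually_eq_shift (h : IsSignaturePair κ κ') {t t' : ℝ}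
    (hp : IsSimplePoint (range (sigPair κ κ')) (sigPair κ κ' t))
    (htt : sigPair κ κ' t = sigPair κ κ' t') :
    ∀ᶠ s in 𝓝 (0 : ℝ), sigPair κ κ' (t + s) = sigPair κ κ' (t' + s) := by
  obtain ⟨δ, hδ, hi⟩ := h.exists_injOn t'
  rw [htt] at hp
  obtain ⟨φ, ε, hε, hφt, hφc, hφ⟩ := exists_local_reparametrization h.continuous_sigPair
    mem_range_self h.continuous_sigPair mem_range_self hδ hi hp htt
  obtain ⟨d, hd, hne⟩ := h.exists_ne_zero t
  -- The relations `κ ∘ φ = κ` and `κ' ∘ φ = κ'` together force slope one wherever `κ'` does not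
  -- vanish.
  have hder : ∀ s ∈ Ioo (t - ε) (t + ε), |s - t| ≤ d → s ≠ t → HasDerivAt φ 1 s := by
    intro s hs hsd hst
    have hnh : Ioo (t - ε) (t + ε) ∈ 𝓝 s := Ioo_mem_nhds hs.1 hs.2
    have heq : κ' (φ s) = κ' s := congrArg Prod.snd (hφ s hs).2
    have h0 := hne s hsd hst
    have := hasDerivAt_of_comp_eq (hφc.continuousAt hnh) (h.hasDerivAt (φ s)) (by rwa [heq])
      (h.hasDerivAt s) (by
        filter_upwards [hnh] with x hx using congrArg Prod.fst (hφ x hx).2)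
    rwa [heq, div_self h0] at this
  -- The derivative at `t` itself may be unknown; the mean value theorem on intervals ending at `t`
  -- does not need it.
  have hsl : ∀ x ∈ Ioo (t - ε) (t + ε), ∀ y ∈ Ioo (t - ε) (t + ε), x < y →
      (∀ s ∈ Ioo x y, |s - t| ≤ d ∧ s ≠ t) → φ y - φ x = y - x := by
    intro x hx y hy hxy hs
    obtain ⟨z, hz, hz'⟩ := exists_hasDerivAt_eq_slope φ (fun _ => 1) hxy
      (hφc.mono (Icc_subset_Ioo hx.1 hy.2))
      (fun z hz => hder z ⟨by linarith [hx.1, hz.1], by linarith [hy.2, hz.2]⟩ (hs z hz).1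
        (hs z hz).2)
    rw [eq_div_iff (by linarith)] at hz'
    linarith
  filter_upwards [Ioo_mem_nhds (neg_lt_zero.2 (lt_min hε hd)) (lt_min hε hd)] with s hs
  have hsε : -ε < s ∧ s < ε := ⟨by linarith [hs.1, min_le_left ε d], by
    linarith [hs.2, min_le_left ε d]⟩
  have hsd : -d < s ∧ s < d := ⟨by linarith [hs.1, min_le_right ε d], by
    linarith [hs.2, min_le_right ε d]⟩
  have h1 : t + s ∈ Ioo (t - ε) (t + ε) := ⟨by linarith [hsε.1], by linarith [hsε.2]⟩
  have h2 : t ∈ Ioo (t - ε) (t + ε) := ⟨by linarith, by linarith⟩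
  have h3 : φ (t + s) = t' + s := by
    rcases lt_trichotomy s 0 with h0 | h0 | h0
    · have := hsl (t + s) h1 t h2 (by linarith) fun u hu =>
        ⟨abs_le.2 ⟨by linarith [hu.1], by linarith [hu.2]⟩, hu.2.ne⟩
      linarith
    · simp [h0, hφt]
    · have := hsl t h2 (t + s) h1 (by linarith) fun u hu =>
        ⟨abs_le.2 ⟨by linarith [hu.1], by linarith [hu.2]⟩, hu.1.ne'⟩
      linarith
  rw [← h3, (hφ _ h1).2]

end LocalStructure

/-! ### Edges of the quiver and the arcs that trace them -/

section Edges

lemma QuiverEdge.subset {S : Set (ℝ × ℝ)} (E : QuiverEdge S) :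
    E.1 ⊆ S \ selfIntersections S := by
  obtain ⟨ζ, _, h⟩ := E.2
  rw [h]
  exact connectedComponentIn_subset _ _

lemma QuiverEdge.isPreconnected {S : Set (ℝ × ℝ)} (E : QuiverEdge S) : IsPreconnected E.1 := by
  obtain ⟨ζ, _, h⟩ := E.2
  rw [h]
  exact isPreconnected_connectedComponentIn

lemma QuiverEdge.eq_connectedComponentIn {S : Set (ℝ × ℝ)} (E : QuiverEdge S) {q : ℝ × ℝ}
    (hq : q ∈ E.1) : E.1 = connectedComponentIn (S \ selfIntersections S) q := by
  obtain ⟨ζ, _, h⟩ := E.2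
  rw [h] at hq ⊢
  exact connectedComponentIn_eq hq

lemma QuiverEdge.eq_of_mem {S : Set (ℝ × ℝ)} {E F : QuiverEdge S} {q : ℝ × ℝ}
    (hE : q ∈ E.1) (hF : q ∈ F.1) : E = F :=
  Subtype.ext ((E.eq_connectedComponentIn hE).trans (F.eq_connectedComponentIn hF).symm)

lemma QuiverEdge.subset_of_isPreconnected {S : Set (ℝ × ℝ)} (E : QuiverEdge S) {T : Set (ℝ × ℝ)}
    {q : ℝ × ℝ} (hT : IsPreconnected T) (hTS : T ⊆ S \ selfIntersections S) (hqT : q ∈ T)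
    (hqE : q ∈ E.1) : T ⊆ E.1 := by
  rw [E.eq_connectedComponentIn hqE]
  exact hT.subset_connectedComponentIn hqT hTS

lemma QuiverEdge.isSimplePoint {S : Set (ℝ × ℝ)} (E : QuiverEdge S) {q : ℝ × ℝ} (hq : q ∈ E.1) :
    IsSimplePoint S q := by
  have h := E.subset hq
  by_contra hn
  exact h.2 ⟨h.1, hn⟩

lemma isOpen_setOf_isSimplePoint {X : Type*} [TopologicalSpace X] (Γ : Set X) :
    IsOpen {p | IsSimplePoint Γ p} := by
  rw [isOpen_iff_mem_nhds]
  rintro p ⟨U, hU, hp, h⟩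
  exact Filter.mem_of_superset (hU.mem_nhds hp) fun q hq => ⟨U, hU, hq, h⟩

variable {κ κ' : ℝ → ℝ}

lemma mem_regular_iff {S : Set (ℝ × ℝ)} {q : ℝ × ℝ} (hq : q ∈ S) :
    q ∈ S \ selfIntersections S ↔ IsSimplePoint S q := by
  simp [selfIntersections, hq]

/-- Being simple is an open condition, so a small interval around `x` maps to a connected set of
simple points, which cannot leave the component. -/
lemma QuiverEdge.isOpen_preimage (h : IsSignaturePair κ κ')
    (E : QuiverEdge (range (sigPair κ κ'))) : IsOpen (sigPair κ κ' ⁻¹' E.1) := by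
  rw [isOpen_iff_mem_nhds]
  intro x hx
  have ho := (isOpen_setOf_isSimplePoint (range (sigPair κ κ'))).preimage h.continuous_sigPair
  obtain ⟨ε, hε, hb⟩ := Metric.mem_nhds_iff.1 (ho.mem_nhds (E.isSimplePoint hx))
  refine Filter.mem_of_superset (Metric.ball_mem_nhds x hε) ?_
  rw [← image_subset_iff]
  refine E.subset_of_isPreconnected
    ((convex_ball x ε).isPreconnected.image _ h.continuous_sigPair.continuousOn) ?_
    (mem_image_of_mem _ (Metric.mem_ball_self hε)) hx
  rintro _ ⟨y, hy, rfl⟩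
  exact (mem_regular_iff (mem_range_self y)).2 (hb hy)

/-- Two parameters with the same value on an edge have components of the preimage of the edge that
are translates of each other. -/
lemma QuiverEdge.translate (h : IsSignaturePair κ κ') (E : QuiverEdge (range (sigPair κ κ')))
    {t t' x : ℝ} (ht : t ∈ sigPair κ κ' ⁻¹' E.1) (htt : sigPair κ κ' t = sigPair κ κ' t')
    (hx : x ∈ connectedComponentIn (sigPair κ κ' ⁻¹' E.1) t) :
    x + (t' - t) ∈ connectedComponentIn (sigPair κ κ' ⁻¹' E.1) t' ∧
      sigPair κ κ' (x + (t' - t)) = sigPair κ κ' x := by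
  set C := connectedComponentIn (sigPair κ κ' ⁻¹' E.1) t with hC
  have hCE : C ⊆ sigPair κ κ' ⁻¹' E.1 := connectedComponentIn_subset _ _
  -- The coincidence set of the signature map with its translate is closed, and local rigidity makes
  -- it a neighbourhood of each of its points in `C`; connectedness then gives `C ⊆ A`.
  set A : Set ℝ := {y | sigPair κ κ' y = sigPair κ κ' (y + (t' - t))} with hA
  have hAc : IsClosed A := isClosed_eq h.continuous_sigPair
    (h.continuous_sigPair.comp (continuous_id.add continuous_const))
  have hAi : A ∩ C ⊆ interior A := by
    rintro y ⟨hyA, hyC⟩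
    rw [mem_interior_iff_mem_nhds]
    have hev := h.eventually_eq_shift (E.isSimplePoint (hCE hyC)) hyA
    have htend : Filter.Tendsto (fun z => z - y) (𝓝 y) (𝓝 0) := by
      have : ContinuousAt (fun z : ℝ => z - y) y := by fun_prop
      simpa [ContinuousAt] using this
    filter_upwards [htend.eventually hev] with z hz
    have e1 : y + (z - y) = z := by ring
    have e2 : y + (t' - t) + (z - y) = z + (t' - t) := by ring
    rw [e1, e2] at hz
    exact hz
  have htC : t ∈ C := mem_connectedComponentIn ht
  have htA : t ∈ A := by
    have : t + (t' - t) = t' := by ring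
    rw [hA, mem_ofPred_eq, this]
    exact htt
  have hCA : C ⊆ A := by
    refine (isPreconnected_connectedComponentIn.subset_of_closure_inter_subset isOpen_interior
      ⟨t, htC, hAi ⟨htA, htC⟩⟩ ?_).trans interior_subset
    rintro y ⟨hy, hyC⟩
    exact hAi ⟨(closure_minimal interior_subset hAc) hy, hyC⟩
  refine ⟨?_, (hCA hx).symm⟩
  have hpre : IsPreconnected ((fun y => y + (t' - t)) '' C) :=
    isPreconnected_connectedComponentIn.image _ (by fun_prop)
  refine hpre.subset_connectedComponentIn ⟨t, htC, by ring⟩ ?_ (mem_image_of_mem _ hx)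
  rintro _ ⟨y, hy, rfl⟩
  have := hCA hy
  rw [mem_preimage, ← this]
  exact hCE hy

/-- Every component of the preimage of an edge traces the whole edge. -/
lemma QuiverEdge.exists_mem_component (h : IsSignaturePair κ κ')
    (E : QuiverEdge (range (sigPair κ κ'))) {x : ℝ} {q : ℝ × ℝ}
    (hx : x ∈ sigPair κ κ' ⁻¹' E.1) (hq : q ∈ E.1) :
    ∃ y ∈ connectedComponentIn (sigPair κ κ' ⁻¹' E.1) x, sigPair κ κ' y = q := by
  -- The relation "every lift of `p` has a lift of `q` in its component" is transitive, is symmetric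
  -- by translating a single lift, and holds locally since a short arc covers a neighbourhood in
  -- `S`. Preconnectedness of the edge spreads it to all pairs.
  have key := E.isPreconnected.induction₂ (P := fun p q => ∀ x, sigPair κ κ' x = p →
      ∃ y ∈ connectedComponentIn (sigPair κ κ' ⁻¹' E.1) x, sigPair κ κ' y = q) ?_ ?_ ?_ hx hq
  · exact key x rfl
  · intro p hp
    obtain ⟨x₀, rfl⟩ := (E.subset hp).1
    have hx₀ : x₀ ∈ sigPair κ κ' ⁻¹' E.1 := hp
    obtain ⟨δ, hδ, hi⟩ := h.exists_injOn x₀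
    obtain ⟨ε, hε, hb⟩ := Metric.mem_nhds_iff.1
      (((E.isOpen_preimage h).connectedComponentIn (x := x₀)).mem_nhds
        (mem_connectedComponentIn hx₀))
    set d := min δ (ε / 2) with hd
    have hd0 : 0 < d := lt_min hδ (by linarith)
    have hd1 : d ≤ δ := min_le_left _ _
    have hd2 : d ≤ ε / 2 := min_le_right _ _
    have hn := image_Icc_mem_nhdsWithin h.continuous_sigPair mem_range_self hd0
      (hi.mono (Icc_subset_Icc (by linarith) (by linarith))) (E.isSimplePoint hp)
    filter_upwards [nhdsWithin_mono _ (fun q hq => (E.subset hq).1) hn]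
    rintro _ ⟨y, hy, rfl⟩ x hxx
    have hyC : y ∈ connectedComponentIn (sigPair κ κ' ⁻¹' E.1) x₀ := by
      refine hb ?_
      rw [Metric.mem_ball, Real.dist_eq, abs_lt]
      constructor <;> linarith [hy.1, hy.2]
    have := E.translate h hx₀ hxx.symm hyC
    exact ⟨_, this.1, this.2⟩
  · intro p q r _ _ _ hpq hqr x hxp
    obtain ⟨y, hy, hyq⟩ := hpq x hxp
    obtain ⟨z, hz, hzr⟩ := hqr y hyq
    rw [← connectedComponentIn_eq hy] at hz
    exact ⟨z, hz, hzr⟩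
  · intro p q hp hq hpq y hy
    obtain ⟨x, rfl⟩ := (E.subset hp).1
    obtain ⟨y', hy', hyq'⟩ := hpq x rfl
    have hxm : x ∈ connectedComponentIn (sigPair κ κ' ⁻¹' E.1) y' := by
      rw [← connectedComponentIn_eq hy']
      exact mem_connectedComponentIn hp
    have hy'E : y' ∈ sigPair κ κ' ⁻¹' E.1 := connectedComponentIn_subset _ _ hy'
    have := E.translate h hy'E (hyq'.trans hy.symm) hxm
    exact ⟨_, this.1, this.2⟩

variable {E : QuiverEdge (range (sigPair κ κ'))} {a b a' b' : ℝ}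

lemma IsEdgeArc.lt (hE : IsEdgeArc (sigPair κ κ') E a b) : a < b := by
  obtain ⟨t, ht, hC⟩ := hE
  have := mem_connectedComponentIn ht
  rw [hC] at this
  exact this.1.trans this.2

lemma IsEdgeArc.mapsTo (hE : IsEdgeArc (sigPair κ κ') E a b) :
    MapsTo (sigPair κ κ') (Ioo a b) E.1 := by
  obtain ⟨t, ht, hC⟩ := hE
  rw [← hC]
  exact fun x hx => connectedComponentIn_subset (sigPair κ κ' ⁻¹' E.1) t hx

lemma IsEdgeArc.component_eq (hE : IsEdgeArc (sigPair κ κ') E a b) {x : ℝ} (hx : x ∈ Ioo a b) :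
    connectedComponentIn (sigPair κ κ' ⁻¹' E.1) x = Ioo a b := by
  obtain ⟨t, ht, hC⟩ := hE
  rw [← hC] at hx ⊢
  exact (connectedComponentIn_eq hx).symm

lemma IsEdgeArc.translate_le (h : IsSignaturePair κ κ') (hE : IsEdgeArc (sigPair κ κ') E a b)
    (hE' : IsEdgeArc (sigPair κ κ') E a' b') {x y : ℝ} (hx : x ∈ Ioo a b) (hy : y ∈ Ioo a' b')
    (hxy : sigPair κ κ' x = sigPair κ κ' y) : a' ≤ a + (y - x) ∧ b + (y - x) ≤ b' := by
  have hsub : Ioo (a + (y - x)) (b + (y - x)) ⊆ Ioo a' b' := by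
    intro z hz
    have hz' : z - (y - x) ∈ connectedComponentIn (sigPair κ κ' ⁻¹' E.1) x := by
      rw [hE.component_eq hx]
      exact ⟨by linarith [hz.1], by linarith [hz.2]⟩
    have := (E.translate h (hE.mapsTo hx) hxy hz').1
    rwa [hE'.component_eq hy, sub_add_cancel] at this
  exact (Ioo_subset_Ioo_iff (by linarith [hE.lt])).1 hsub

/-- A bounded interval contains no nontrivial translate of itself, so a coincidence within one arc
has zero shift. -/
lemma IsEdgeArc.injOn (h : IsSignaturePair κ κ') (hE : IsEdgeArc (sigPair κ κ') E a b) :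
    InjOn (sigPair κ κ') (Ioo a b) := by
  intro x hx y hy hxy
  have := hE.translate_le h hE hx hy hxy
  linarith [this.1, this.2]

/-- The midpoint of the first arc has a partner in the second; the resulting translate of each arc
lies in the other, so the lengths agree. Continuity extends the coincidence to the endpoints. -/
lemma IsEdgeArc.eq_shift (h : IsSignaturePair κ κ') (hE : IsEdgeArc (sigPair κ κ') E a b)
    (hE' : IsEdgeArc (sigPair κ κ') E a' b') :
    b - a = b' - a' ∧ ∀ s ∈ Icc 0 (b - a), sigPair κ κ' (a + s) = sigPair κ κ' (a' + s) := by
  have hm : (a + b) / 2 ∈ Ioo a b := ⟨by linarith [hE.lt], by linarith [hE.lt]⟩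
  have hm' : (a' + b') / 2 ∈ Ioo a' b' := ⟨by linarith [hE'.lt], by linarith [hE'.lt]⟩
  obtain ⟨y, hy, hxy⟩ := E.exists_mem_component h (hE'.mapsTo hm') (hE.mapsTo hm)
  rw [hE'.component_eq hm'] at hy
  have h1 := hE.translate_le h hE' hm hy hxy.symm
  have h2 := hE'.translate_le h hE hy hm hxy
  have ha : a + (y - (a + b) / 2) = a' := by linarith [h1.1, h2.1]
  refine ⟨by linarith [h1.1, h2.1, h1.2, h2.2], ?_⟩
  have hoo : EqOn (fun s => sigPair κ κ' (a + s)) (fun s => sigPair κ κ' (a' + s))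
      (Ioo 0 (b - a)) := by
    intro s hs
    have hs' : a + s ∈ connectedComponentIn (sigPair κ κ' ⁻¹' E.1) ((a + b) / 2) := by
      rw [hE.component_eq hm]
      exact ⟨by linarith [hs.1], by linarith [hs.2]⟩
    have := (E.translate h (hE.mapsTo hm) hxy.symm hs').2
    have e : a + s + (y - (a + b) / 2) = a' + s := by linarith
    rw [e] at this
    exact this.symm
  have hcl := hoo.closure (h.continuous_sigPair.comp (by fun_prop))
    (h.continuous_sigPair.comp (by fun_prop))
  rw [closure_Ioo (by linarith [hE.lt])] at hcl
  exact hcl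

/-- A simple endpoint value, being adherent to the edge, would belong to it, and the arc could then
be enlarged by that endpoint, against maximality. -/
lemma IsEdgeArc.endpoint_notMem (h : IsSignaturePair κ κ')
    (hE : IsEdgeArc (sigPair κ κ') E a b) {x : ℝ} (hx : x ∈ Icc a b) (hx' : x ∉ Ioo a b) :
    ¬ IsSimplePoint (range (sigPair κ κ')) (sigPair κ κ' x) := by
  intro hs
  have hxcl : x ∈ closure (Ioo a b) := by rwa [closure_Ioo hE.lt.ne]
  have hcl : sigPair κ κ' x ∈ closure E.1 :=
    map_mem_closure h.continuous_sigPair hxcl hE.mapsTo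
  have hm : (a + b) / 2 ∈ Ioo a b := ⟨by linarith [hE.lt], by linarith [hE.lt]⟩
  have hpre : IsPreconnected (insert (sigPair κ κ' x) E.1) :=
    E.isPreconnected.subset_closure (subset_insert _ _) (insert_subset hcl subset_closure)
  have hxE : sigPair κ κ' x ∈ E.1 :=
    E.subset_of_isPreconnected hpre
      (insert_subset ((mem_regular_iff (mem_range_self x)).2 hs) E.subset)
      (mem_insert_of_mem _ (hE.mapsTo hm)) (hE.mapsTo hm) (mem_insert _ _)
  have hpre' : IsPreconnected (insert x (Ioo a b)) :=
    isPreconnected_Ioo.subset_closure (subset_insert _ _) (insert_subset hxcl subset_closure)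
  have hsub := hpre'.subset_connectedComponentIn (mem_insert_of_mem x hm)
    (insert_subset hxE hE.mapsTo : insert x (Ioo a b) ⊆ sigPair κ κ' ⁻¹' E.1)
  rw [hE.component_eq hm] at hsub
  exact hx' (hsub (mem_insert _ _))

lemma IsEdgeArc.left_notMem (h : IsSignaturePair κ κ') (hE : IsEdgeArc (sigPair κ κ') E a b) :
    ¬ IsSimplePoint (range (sigPair κ κ')) (sigPair κ κ' a) :=
  hE.endpoint_notMem h (left_mem_Icc.2 hE.lt.le) fun hx => lt_irrefl _ hx.1

/-- `Follows` only speaks of some pair of arcs; `IsEdgeArc.eq_shift` transfers the matching to any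
chosen pair. -/
lemma Follows.eq (h : IsSignaturePair κ κ') {F : QuiverEdge (range (sigPair κ κ'))}
    (hEF : Follows (sigPair κ κ') E F) (hE : IsEdgeArc (sigPair κ κ') E a b)
    (hF : IsEdgeArc (sigPair κ κ') F a' b') : sigPair κ κ' b = sigPair κ κ' a' := by
  obtain ⟨q, ⟨c, d, hcd, hq⟩, ⟨e, f, hef, hq'⟩⟩ := hEF
  have h1 := hE.eq_shift h hcd
  have h2 := hF.eq_shift h hef
  have e1 := h1.2 (b - a) (right_mem_Icc.2 (by linarith [hE.lt]))
  have e2 := h2.2 0 (left_mem_Icc.2 (by linarith [hF.lt]))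
  rw [h1.1] at e1
  rw [← h1.1, add_sub_cancel, h1.1, add_sub_cancel] at e1
  rw [add_zero, add_zero] at e2
  rw [e1, e2, hq, hq']

lemma IsEdgeArc.integral_eq (h : IsSignaturePair κ κ') (hE : IsEdgeArc (sigPair κ κ') E a b)
    (hE' : IsEdgeArc (sigPair κ κ') E a' b') : ∫ s in a..b, κ s = ∫ s in a'..b', κ s := by
  have h1 := hE.eq_shift h hE'
  have e : ∀ c d : ℝ, ∫ s in c..d, κ s = ∫ s in (0 : ℝ)..(d - c), κ (c + s) := by
    intro c d
    rw [intervalIntegral.integral_comp_add_left (fun s => κ s) c]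
    simp
  rw [e a b, e a' b', ← h1.1]
  refine intervalIntegral.integral_congr fun s hs => ?_
  rw [uIcc_of_le (by linarith [hE.lt])] at hs
  exact congrArg Prod.fst (h1.2 s hs)

end Edges

/-! ### Cyclic words, their periods and multiplicities -/

section Words

variable {α : Type*}

/-- The `j`-th letter of the bi-infinite periodic word `⋯lll⋯`. -/
def cyclicGet (l : List α) (hl : l ≠ []) (j : ℤ) : α :=
  l[(j % l.length).toNat]'(by
    have h := List.length_pos_iff.2 hl
    have h1 := Int.emod_lt_of_pos j (show (0 : ℤ) < l.length by exact_mod_cast h)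
    have h2 := Int.emod_nonneg j (show (l.length : ℤ) ≠ 0 by exact_mod_cast h.ne')
    omega)

lemma cyclicGet_natCast (l : List α) (hl : l ≠ []) {r : ℕ} (hr : r < l.length) :
    cyclicGet l hl r = l[r] := by
  have : ((r : ℤ) % l.length).toNat = r := by
    rw [← Int.natCast_mod, Int.toNat_natCast, Nat.mod_eq_of_lt hr]
  simp only [cyclicGet, this]

lemma cyclicGet_of_emod_eq (l : List α) (hl : l ≠ []) {i j : ℤ}
    (h : i % l.length = j % l.length) : cyclicGet l hl i = cyclicGet l hl j := by
  simp only [cyclicGet, h]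

lemma cyclicGet_emod (l : List α) (hl : l ≠ []) (j : ℤ) :
    cyclicGet l hl (j % l.length) = cyclicGet l hl j :=
  cyclicGet_of_emod_eq l hl (Int.emod_emod_of_dvd _ dvd_rfl)

lemma cyclicGet_periodic (l : List α) (hl : l ≠ []) :
    Function.Periodic (cyclicGet l hl) l.length := fun j =>
  cyclicGet_of_emod_eq l hl (Int.add_emod_right j l.length)

lemma exists_natCast_emod (l : List α) (hl : l ≠ []) (j : ℤ) :
    ∃ r : ℕ, r < l.length ∧ j % l.length = r := by
  have h := List.length_pos_iff.2 hl
  have h1 := Int.emod_lt_of_pos j (show (0 : ℤ) < l.length by exact_mod_cast h)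
  have h2 := Int.emod_nonneg j (show (l.length : ℤ) ≠ 0 by exact_mod_cast h.ne')
  exact ⟨(j % l.length).toNat, by omega, by omega⟩

lemma exists_cyclicGet_eq (l : List α) (hl : l ≠ []) (j : ℤ) :
    ∃ (r : ℕ) (hr : r < l.length), j % l.length = r ∧ cyclicGet l hl j = l[r] := by
  obtain ⟨r, hr, h⟩ := exists_natCast_emod l hl j
  refine ⟨r, hr, h, ?_⟩
  rw [← cyclicGet_natCast l hl hr, ← h, cyclicGet_emod]

lemma wordPow_succ (w : List α) (m : ℕ) : wordPow w (m + 1) = w ++ wordPow w m := by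
  simp [wordPow, List.replicate_succ]

lemma length_wordPow (w : List α) (m : ℕ) : (wordPow w m).length = m * w.length := by
  simp [wordPow]

lemma getElem_wordPow (w : List α) (hw : w ≠ []) (m i : ℕ) (hi : i < (wordPow w m).length) :
    (wordPow w m)[i] = cyclicGet w hw i := by
  induction m generalizing i with
  | zero => simp [wordPow] at hi
  | succ m ih =>
    simp only [wordPow_succ, List.getElem_append]
    split_ifs with h
    · rw [cyclicGet_natCast w hw h]
    · rw [ih]
      apply cyclicGet_of_emod_eq
      rw [Nat.cast_sub (not_lt.1 h), Int.sub_emod_right]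

lemma cyclicGet_wordPow (w : List α) (hw : w ≠ []) (m : ℕ) (hW : wordPow w m ≠ []) :
    cyclicGet (wordPow w m) hW = cyclicGet w hw := by
  funext j
  obtain ⟨r, hr, h, h'⟩ := exists_cyclicGet_eq (wordPow w m) hW j
  rw [h', getElem_wordPow w hw, ← h]
  apply cyclicGet_of_emod_eq
  rw [length_wordPow]
  push_cast
  exact Int.emod_emod_of_dvd _ (dvd_mul_left _ _)

/-- The periods of the bi-infinite word `⋯www⋯` are the multiples of the length of `w` if `w` is not
a proper power. -/
lemma length_dvd_of_periodic (w : List α) (hw : w ≠ []) (hper : ¬ IsPeriodicWord w) {d : ℤ}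
    (hd : Function.Periodic (cyclicGet w hw) d) : (w.length : ℤ) ∣ d := by
  -- By Bézout the gcd `g` of `|w|` and `d` is also a period. If `g` were smaller than `|w|`, then
  -- `w` would be a proper power of its prefix of length `g`.
  set g := Int.gcd w.length d with hg
  have hn : 0 < w.length := List.length_pos_iff.2 hw
  have hgper : Function.Periodic (cyclicGet w hw) (g : ℤ) := by
    rw [hg, Int.gcd_eq_gcd_ab, mul_comm _ (Int.gcdA _ _), mul_comm d]
    exact ((cyclicGet_periodic w hw).int_mul _).add_period (hd.int_mul _)
  have hgn : g ∣ w.length := by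
    have := Int.gcd_dvd_left (w.length : ℤ) d
    exact_mod_cast this
  have hgpos : 0 < g := Nat.pos_of_dvd_of_pos hgn hn
  obtain ⟨k, hk⟩ := hgn
  have hgle : g ≤ w.length := Nat.le_of_dvd hn ⟨k, hk⟩
  by_cases hk1 : 1 < k
  · exfalso
    have hlen : (w.take g).length = g := by simp [hgle]
    have hu : w.take g ≠ [] := by
      rw [← List.length_pos_iff, hlen]; exact hgpos
    refine hper ⟨w.take g, k, hk1, ?_⟩
    refine List.ext_getElem (by rw [length_wordPow, hlen, hk, mul_comm]) fun i h1 h2 => ?_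
    rw [getElem_wordPow _ hu, ← cyclicGet_natCast w hw h1]
    obtain ⟨r, hr, h, h'⟩ := exists_cyclicGet_eq (w.take g) hu i
    rw [h', List.getElem_take, ← cyclicGet_natCast w hw (lt_of_lt_of_le hr (by simp))]
    rw [hlen] at h
    rw [← h, Int.emod_def, mul_comm]
    exact ((hgper.int_mul ((i : ℤ) / g)).sub_eq _).symm
  · have hk' : k = 1 := by
      rcases Nat.lt_or_ge 0 k with h | h
      · omega
      · have : k = 0 := by omega
        rw [this] at hk; omega
    rw [hk', mul_one] at hk
    rw [hk]
    exact Int.gcd_dvd_right (w.length : ℤ) d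

lemma encard_cyclicGet_eq (l : List α) (hl : l ≠ []) (x : α) :
    {r : ℤ | 0 ≤ r ∧ r < l.length ∧ cyclicGet l hl r = x}.encard = (multiplicity l x : ℕ∞) := by
  classical
  have key : ∀ l : List α, {r : ℕ | l[r]? = some x}.encard = (l.count x : ℕ∞) := by
    intro l
    induction l with
    | nil => simp
    | cons y l ih =>
      have hS : {r : ℕ | (y :: l)[r]? = some x} =
          (if y = x then {0} else ∅) ∪ Nat.succ '' {r : ℕ | l[r]? = some x} := by
        ext r
        rcases r with _ | r
        · by_cases h : y = x <;> simp [h]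
        · by_cases h : y = x <;> simp [h]
      have hdisj : Disjoint (if y = x then ({0} : Set ℕ) else ∅)
          (Nat.succ '' {r : ℕ | l[r]? = some x}) := by
        rw [Set.disjoint_left]
        rintro r hr ⟨r', _, rfl⟩
        by_cases h : y = x <;> simp [h] at hr
      rw [hS, encard_union_eq hdisj, Nat.succ_injective.encard_image, ih, List.count_cons]
      by_cases h : y = x <;> simp [h, add_comm]
  have hcast : {r : ℤ | 0 ≤ r ∧ r < l.length ∧ cyclicGet l hl r = x} =
      ((↑) : ℕ → ℤ) '' {r : ℕ | l[r]? = some x} := by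
    ext r
    constructor
    · rintro ⟨h0, h1, h2⟩
      lift r to ℕ using h0
      have hr : r < l.length := by exact_mod_cast h1
      refine ⟨r, ?_, rfl⟩
      rw [cyclicGet_natCast l hl hr] at h2
      rw [mem_ofPred_eq, List.getElem?_eq_getElem hr, h2]
    · rintro ⟨r, hr, rfl⟩
      obtain ⟨hr, h⟩ := List.getElem?_eq_some_iff.1 hr
      exact ⟨by positivity, by exact_mod_cast hr, (cyclicGet_natCast l hl hr).trans h⟩
  rw [hcast, Nat.cast_injective.encard_image, key]
  unfold multiplicity
  congr!

/-- The alphabet need not be finite; the support of the sum lies among the letters of `W`. -/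
lemma finsum_multiplicity_mul (W : List α) (f : α → ℝ) :
    ∑ᶠ E, (multiplicity W E : ℝ) * f E = (W.map f).sum := by
  classical
  have hm : ∀ E, multiplicity W E = W.count E := fun E => by
    unfold multiplicity
    congr!
  rw [Finset.sum_list_map_count, finsum_eq_sum_of_support_subset (s := W.toFinset)]
  · exact Finset.sum_congr rfl fun E _ => by rw [hm, nsmul_eq_mul]
  · intro E hE
    by_contra hn
    refine hE ?_
    have : E ∉ W := fun h => hn (by simpa using h)
    simp [hm, List.count_eq_zero_of_not_mem this]

end Words

/-! ### Breakpoints of the periodic concatenation -/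

section Reshuffle

lemma totalLength_cons (p : ℝ × ℝ) (I : List (ℝ × ℝ)) :
    totalLength (p :: I) = p.2 - p.1 + totalLength I := by
  simp [totalLength]

lemma totalLength_take_succ (I : List (ℝ × ℝ)) {r : ℕ} (hr : r < I.length) :
    totalLength (I.take (r + 1)) = totalLength (I.take r) + (I[r].2 - I[r].1) := by
  simp only [totalLength, List.map_take]
  rw [List.sum_take_succ _ _ (by simpa using hr)]
  simp

lemma totalLength_nonneg {I : List (ℝ × ℝ)} (hI : ∀ p ∈ I, p.1 < p.2) : 0 ≤ totalLength I := by
  refine List.sum_nonneg fun x hx => ?_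
  obtain ⟨p, hp, rfl⟩ := List.mem_map.1 hx
  linarith [hI p hp]

lemma concatenate_eq (κ : ℝ → ℝ) {I : List (ℝ × ℝ)} (hI : ∀ p ∈ I, p.1 < p.2) {r : ℕ}
    (hr : r < I.length) {s : ℝ}
    (hs : s ∈ Ico (totalLength (I.take r)) (totalLength (I.take (r + 1)))) :
    concatenate κ I s = κ (s - totalLength (I.take r) + I[r].1) := by
  induction I generalizing r s with
  | nil => simp at hr
  | cons p I ih =>
    have hI' : ∀ p ∈ I, p.1 < p.2 := fun q hq => hI q (List.mem_cons_of_mem _ hq)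
    rcases r with _ | r
    · simp only [List.take_zero, zero_add, List.take_succ_cons, totalLength_cons, mem_Ico] at hs
      have h0 : totalLength ([] : List (ℝ × ℝ)) = 0 := by simp [totalLength]
      rw [h0] at hs
      simp only [concatenate, List.take_zero, h0, List.getElem_cons_zero, sub_zero]
      rw [if_pos (by linarith [hs.2])]
    · simp only [List.take_succ_cons, totalLength_cons, mem_Ico] at hs
      have hnn : 0 ≤ totalLength (I.take r) :=
        totalLength_nonneg fun q hq => hI' q (List.mem_of_mem_take hq)
      simp only [concatenate, List.take_succ_cons, totalLength_cons, List.getElem_cons_succ]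
      rw [if_neg (by linarith [hs.1]),
        ih hI' (Nat.lt_of_succ_lt_succ hr) ⟨by linarith [hs.1], by linarith [hs.2]⟩]
      congr 1
      ring

/-- The breakpoints of the periodic concatenation of a list of intervals. -/
def breakpoint (I : List (ℝ × ℝ)) (j : ℤ) : ℝ :=
  totalLength I * (j / I.length : ℤ) + totalLength (I.take (j % I.length).toNat)

lemma breakpoint_of_nonneg {I : List (ℝ × ℝ)} {r : ℕ} (hr : r < I.length) (q : ℤ) :
    breakpoint I (r + I.length * q) = totalLength I * q + totalLength (I.take r) := by
  have hn : (I.length : ℤ) ≠ 0 := by omega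
  unfold breakpoint
  rw [Int.add_mul_ediv_left _ _ hn, Int.add_mul_emod_self_left,
    Int.ediv_eq_zero_of_lt (by positivity) (by exact_mod_cast hr),
    Int.emod_eq_of_lt (by positivity) (by exact_mod_cast hr), zero_add, Int.toNat_natCast]

/-- Admitting `r = I.length` lets the index `r + 1` be treated without a separate case for the
wrap-around. -/
lemma breakpoint_of_le {I : List (ℝ × ℝ)} (hI : I ≠ []) {r : ℕ} (hr : r ≤ I.length) (q : ℤ) :
    breakpoint I (r + I.length * q) = totalLength I * q + totalLength (I.take r) := by
  rcases hr.lt_or_eq with h | rfl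
  · exact breakpoint_of_nonneg h q
  · have := breakpoint_of_nonneg (List.length_pos_iff.2 hI) (q + 1)
    have e : ((0 : ℕ) : ℤ) + I.length * (q + 1) = I.length + I.length * q := by push_cast; ring
    rw [e] at this
    rw [this, List.take_zero, List.take_length]
    simp [totalLength]
    ring

lemma breakpoint_zero (I : List (ℝ × ℝ)) : breakpoint I 0 = 0 := by
  simp [breakpoint, totalLength]

lemma breakpoint_length {I : List (ℝ × ℝ)} (hI : I ≠ []) :
    breakpoint I I.length = totalLength I := by
  simpa using breakpoint_of_le hI le_rfl 0

lemma exists_index {I : List (ℝ × ℝ)} (hI : I ≠ []) (j : ℤ) :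
    ∃ (r : ℕ) (q : ℤ) (hr : r < I.length), j = r + I.length * q ∧ cyclicGet I hI j = I[r] := by
  obtain ⟨r, hr, h, h'⟩ := exists_cyclicGet_eq I hI j
  exact ⟨r, j / I.length, hr, by rw [← h, Int.emod_add_mul_ediv], h'⟩

lemma breakpoint_succ {I : List (ℝ × ℝ)} (hI : I ≠ []) (j : ℤ) :
    breakpoint I (j + 1) =
      breakpoint I j + ((cyclicGet I hI j).2 - (cyclicGet I hI j).1) := by
  obtain ⟨r, q, hr, hj, hg⟩ := exists_index hI j
  have e : j + 1 = ((r + 1 : ℕ) : ℤ) + I.length * q := by rw [hj]; push_cast; ring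
  rw [hg, e, breakpoint_of_le hI hr, hj, breakpoint_of_nonneg hr, totalLength_take_succ I hr]
  ring

lemma totalLength_take_le {I : List (ℝ × ℝ)} (hI : ∀ p ∈ I, p.1 < p.2) (r : ℕ) :
    totalLength (I.take r) ≤ totalLength I := by
  have h1 : totalLength I = totalLength (I.take r) + totalLength (I.drop r) := by
    simp only [totalLength]
    rw [← List.sum_append, ← List.map_append, List.take_append_drop]
  have := totalLength_nonneg (I := I.drop r) fun p hp => hI p (List.mem_of_mem_drop hp)
  linarith

lemma reshuffle_eq (κ : ℝ → ℝ) {I : List (ℝ × ℝ)} (hI : I ≠ []) (hlt : ∀ p ∈ I, p.1 < p.2)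
    {j : ℤ} {s : ℝ} (hs : s ∈ Ico (breakpoint I j) (breakpoint I (j + 1))) :
    reshuffle κ I s = κ (s - breakpoint I j + (cyclicGet I hI j).1) := by
  obtain ⟨r, q, hr, hj, hg⟩ := exists_index hI j
  have e : j + 1 = ((r + 1 : ℕ) : ℤ) + I.length * q := by rw [hj]; push_cast; ring
  rw [e, breakpoint_of_le hI hr, hj, breakpoint_of_nonneg hr] at hs
  rw [hg, hj, breakpoint_of_nonneg hr]
  have h0 : 0 ≤ totalLength (I.take r) :=
    totalLength_nonneg fun q hq => hlt q (List.mem_of_mem_take hq)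
  have h1 := totalLength_take_le hlt (r + 1)
  have hT : 0 < totalLength I := by linarith [hs.1, hs.2]
  have hfl : ⌊s / totalLength I⌋ = q := by
    rw [Int.floor_eq_iff, le_div_iff₀ hT, div_lt_iff₀ hT]
    constructor <;> linarith [hs.1, hs.2]
  unfold reshuffle
  rw [hfl, concatenate_eq κ hlt hr ⟨by linarith [hs.1], by linarith [hs.2]⟩]
  congr 1
  ring

end Reshuffle

/-- `κW` is the concatenation of the restrictions of `κ` to the arcs `(a j, b j)` of the edges
`e j`, with breakpoints `c j`. -/
structure IsArcChain (κ κ' : ℝ → ℝ) (e : ℤ → QuiverEdge (range (sigPair κ κ'))) (a b c : ℤ → ℝ)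
    (κW : ℝ → ℝ) : Prop where
  arc : ∀ j, IsEdgeArc (sigPair κ κ') (e j) (a j) (b j)
  succ : ∀ j, c (j + 1) = c j + (b j - a j)
  zero : c 0 = 0
  match_next : ∀ j, sigPair κ κ' (b j) = sigPair κ κ' (a (j + 1))
  eq_shift : ∀ j, ∀ s ∈ Ico (c j) (c (j + 1)), κW s = κ (s - c j + a j)

/-! ### From a closed path to a bi-infinite chain of arcs -/

section FromList

variable {κ κ' : ℝ → ℝ}

lemma IsClosedPath.follows_cyclicGet {σ : ℝ → ℝ × ℝ} {W : List (QuiverEdge (range σ))}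
    (hW : IsClosedPath σ W) (hne : W ≠ []) (j : ℤ) :
    Follows σ (cyclicGet W hne j) (cyclicGet W hne (j + 1)) := by
  obtain ⟨hch, _, hlast⟩ := hW
  obtain ⟨r, hr, h, h'⟩ := exists_cyclicGet_eq W hne j
  have hj : cyclicGet W hne (j + 1) = cyclicGet W hne ((r : ℤ) + 1) := by
    apply cyclicGet_of_emod_eq
    rw [← h, Int.emod_add_emod]
  rw [h', hj]
  rcases Nat.lt_or_ge (r + 1) W.length with h1 | h1
  · have := cyclicGet_natCast W hne h1
    push_cast at this
    rw [this]
    exact hch.getElem r h1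
  · have hrn : r = W.length - 1 := by omega
    have h0 : cyclicGet W hne ((r : ℤ) + 1) = W[0]'(by omega) := by
      rw [← cyclicGet_natCast W hne (by omega)]
      apply cyclicGet_of_emod_eq
      have : (r : ℤ) + 1 = W.length := by omega
      rw [this]; simp
    rw [h0]
    rw [List.getLast_eq_getElem, List.head_eq_getElem] at hlast
    simpa only [hrn] using hlast

lemma isArcChain_reshuffle (h : IsSignaturePair κ κ')
    {W : List (QuiverEdge (range (sigPair κ κ')))} (hne : W ≠ [])
    (hW : IsClosedPath (sigPair κ κ') W) {I : List (ℝ × ℝ)}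
    (hI : List.Forall₂ (fun E p => IsEdgeArc (sigPair κ κ') E p.1 p.2) W I) (hIne : I ≠ []) :
    IsArcChain κ κ' (cyclicGet W hne) (fun j => (cyclicGet I hIne j).1)
      (fun j => (cyclicGet I hIne j).2) (breakpoint I) (reshuffle κ I) := by
  have hlen := hI.length_eq
  have harc : ∀ j, IsEdgeArc (sigPair κ κ') (cyclicGet W hne j) (cyclicGet I hIne j).1
      (cyclicGet I hIne j).2 := by
    intro j
    obtain ⟨r, hr, h, h'⟩ := exists_cyclicGet_eq W hne j
    obtain ⟨r', hr', hh, hh'⟩ := exists_cyclicGet_eq I hIne j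
    have : r = r' := by rw [hlen] at h; omega
    subst this
    rw [h', hh']
    exact hI.get hr hr'
  have hlt : ∀ p ∈ I, p.1 < p.2 := by
    intro p hp
    obtain ⟨r, hr, rfl⟩ := List.mem_iff_getElem.1 hp
    have := harc r
    rw [cyclicGet_natCast I hIne hr] at this
    exact this.lt
  exact ⟨harc, breakpoint_succ hIne, breakpoint_zero I,
    fun j => (hW.follows_cyclicGet hne j).eq h (harc j) (harc (j + 1)),
    fun j s hs => reshuffle_eq κ hIne hlt hs⟩

end FromList

/-! ### Regularity, periods and fibres of the reshuffled curvature -/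

namespace IsArcChain

variable {κ κ' : ℝ → ℝ} {e : ℤ → QuiverEdge (range (sigPair κ κ'))} {a b c : ℤ → ℝ}
  {κW : ℝ → ℝ}

lemma lt_succ (hc : IsArcChain κ κ' e a b c κW) (j : ℤ) : c j < c (j + 1) := by
  have := (hc.arc j).lt
  rw [hc.succ]
  linarith

lemma strictMono (hc : IsArcChain κ κ' e a b c κW) : StrictMono c :=
  strictMono_int_of_lt_succ hc.lt_succ

lemma length_eq (hc : IsArcChain κ κ' e a b c κW) (h : IsSignaturePair κ κ') {i j : ℤ}
    (hij : e i = e j) : b i - a i = b j - a j := by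
  have h1 := hc.arc i
  rw [hij] at h1
  exact (h1.eq_shift h (hc.arc j)).1

/-- The increments of `c` are arc lengths, which depend only on the edge and so repeat with the
word. -/
lemma add_period (hc : IsArcChain κ κ' e a b c κW) (h : IsSignaturePair κ κ') {d : ℤ}
    (hd : Function.Periodic e d) (j : ℤ) : c (j + d) = c j + c d := by
  induction j using Int.induction_on with
  | zero => rw [hc.zero, zero_add, zero_add]
  | succ i ih =>
    have e1 : (i : ℤ) + 1 + d = i + d + 1 := by ring
    rw [e1, hc.succ, hc.succ, ih, hc.length_eq h (hd i)]
    ring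
  | pred i ih =>
    have h1 := hc.succ (-(i : ℤ) - 1)
    have h2 := hc.succ (-(i : ℤ) - 1 + d)
    have e1 : -(i : ℤ) - 1 + 1 = -i := by ring
    have e2 : -(i : ℤ) - 1 + d + 1 = -i + d := by ring
    rw [e1] at h1
    rw [e2, ih, h1, hc.length_eq h (hd _)] at h2
    linarith

lemma mul_period (hc : IsArcChain κ κ' e a b c κW) (h : IsSignaturePair κ κ') {d : ℤ}
    (hd : Function.Periodic e d) (k : ℤ) : c (k * d) = k * c d := by
  induction k using Int.induction_on with
  | zero => simp [hc.zero]
  | succ i ih =>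
    rw [add_mul, one_mul, hc.add_period h hd, ih]
    push_cast
    ring
  | pred i ih =>
    have := hc.add_period h hd ((-(i : ℤ) - 1) * d)
    have e1 : (-(i : ℤ) - 1) * d + d = -i * d := by ring
    rw [e1, ih] at this
    push_cast at this ⊢
    linarith

/-- Along multiples of `n` the breakpoints form an unbounded arithmetic progression, so the pieces
tile the line. -/
lemma exists_mem_Ico (hc : IsArcChain κ κ' e a b c κW) (h : IsSignaturePair κ κ') {n : ℤ}
    (hn : 0 < n) (he : Function.Periodic e n) (s : ℝ) : ∃ j, s ∈ Ico (c j) (c (j + 1)) := by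
  have hT : 0 < c n := by
    have := hc.strictMono hn
    rwa [hc.zero] at this
  have hex : ∃ z : ℤ, c z ≤ s := by
    refine ⟨⌊s / c n⌋ * n, ?_⟩
    rw [hc.mul_period h he]
    exact (le_div_iff₀ hT).1 (Int.floor_le _)
  have hbdd : ∃ B : ℤ, ∀ z, c z ≤ s → z ≤ B := by
    refine ⟨(⌊s / c n⌋ + 1) * n, fun z hz => ?_⟩
    refine (hc.strictMono.lt_iff_lt.1 (lt_of_le_of_lt hz ?_)).le
    rw [hc.mul_period h he]
    push_cast
    exact (div_lt_iff₀ hT).1 (Int.lt_floor_add_one _)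
  obtain ⟨j, hj, hmax⟩ := Int.exists_greatest_of_bdd hbdd hex
  refine ⟨j, hj, ?_⟩
  by_contra hn'
  have := hmax (j + 1) (not_lt.1 hn')
  omega

lemma exists_mem_Ioc (hc : IsArcChain κ κ' e a b c κW) (h : IsSignaturePair κ κ') {n : ℤ}
    (hn : 0 < n) (he : Function.Periodic e n) (s : ℝ) : ∃ j, s ∈ Ioc (c j) (c (j + 1)) := by
  obtain ⟨j, hj⟩ := hc.exists_mem_Ico h hn he s
  rcases hj.1.lt_or_eq with h1 | h1
  · exact ⟨j, h1, hj.2.le⟩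
  · refine ⟨j - 1, ?_, ?_⟩
    · rw [← h1]; exact hc.strictMono (by omega)
    · rw [sub_add_cancel, h1]

lemma shift_right (hc : IsArcChain κ κ' e a b c κW) (j : ℤ) :
    c (j + 1) - c j + a j = b j := by
  rw [hc.succ]; ring

lemma eq_shift_Icc (hc : IsArcChain κ κ' e a b c κW) {j : ℤ} {s : ℝ}
    (hs : s ∈ Icc (c j) (c (j + 1))) : κW s = κ (s - c j + a j) := by
  rcases hs.2.lt_or_eq with h1 | rfl
  · exact hc.eq_shift j s ⟨hs.1, h1⟩
  · rw [hc.shift_right, hc.eq_shift (j + 1) _ ⟨le_rfl, hc.lt_succ _⟩, sub_self, zero_add]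
    exact (congrArg Prod.fst (hc.match_next j)).symm

lemma hasDerivAt_piece (h : IsSignaturePair κ κ') (s x y : ℝ) :
    HasDerivAt (fun s => κ (s - x + y)) (κ' (s - x + y)) s := by
  have h1 : HasDerivAt (fun s : ℝ => s - x + y) 1 s := ((hasDerivAt_id s).sub_const x).add_const y
  have h2 := (h.hasDerivAt (s - x + y)).comp s h1
  rw [mul_one] at h2
  exact h2

/-- The meeting point of two consecutive arcs is one point of the signature, so both `κ` and `κ'`
match there: the one-sided derivatives at a breakpoint exist, coincide, and depend continuously on
the parameter. -/
lemma exists_derivative (hc : IsArcChain κ κ' e a b c κW) (h : IsSignaturePair κ κ') {n : ℤ}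
    (hn : 0 < n) (he : Function.Periodic e n) :
    ∃ τ : ℝ → ℝ, Continuous τ ∧ (∀ s, HasDerivAt κW (τ s) s) ∧
      ∀ j, ∀ s ∈ Icc (c j) (c (j + 1)), sigPair κW τ s = sigPair κ κ' (s - c j + a j) := by
  choose f hf using hc.exists_mem_Ico h hn he
  have huniq : ∀ j s, s ∈ Ico (c j) (c (j + 1)) → f s = j := by
    intro j s hs
    have h1 := hc.strictMono.lt_iff_lt.1 (lt_of_le_of_lt hs.1 (hf s).2)
    have h2 := hc.strictMono.lt_iff_lt.1 (lt_of_le_of_lt (hf s).1 hs.2)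
    omega
  set τ : ℝ → ℝ := fun s => κ' (s - c (f s) + a (f s)) with hτ
  have hτe : ∀ j, ∀ s ∈ Icc (c j) (c (j + 1)), τ s = κ' (s - c j + a j) := by
    intro j s hs
    rcases hs.2.lt_or_eq with h1 | rfl
    · simp only [hτ, huniq j s ⟨hs.1, h1⟩]
    · rw [hc.shift_right]
      simp only [hτ, huniq (j + 1) _ ⟨le_rfl, hc.lt_succ _⟩, sub_self, zero_add]
      exact (congrArg Prod.snd (hc.match_next j)).symm
  refine ⟨τ, ?_, ?_, fun j s hs => Prod.ext (hc.eq_shift_Icc hs) (hτe j s hs)⟩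
  · rw [continuous_iff_continuousAt]
    intro s
    rw [continuousAt_iff_continuous_left_right]
    obtain ⟨j, hj⟩ := hc.exists_mem_Ioc h hn he s
    obtain ⟨i, hi⟩ := hc.exists_mem_Ico h hn he s
    have hcont : ∀ j : ℤ, Continuous fun s => κ' (s - c j + a j) := fun j =>
      h.continuous_deriv.comp (by fun_prop)
    refine ⟨(hcont j).continuousWithinAt.congr_of_eventuallyEq ?_ (hτe j s (Ioc_subset_Icc_self hj)),
      (hcont i).continuousWithinAt.congr_of_eventuallyEq ?_ (hτe i s (Ico_subset_Icc_self hi))⟩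
    · filter_upwards [Ioc_mem_nhdsLE hj.1] with x hx
      exact hτe j x ⟨hx.1.le, hx.2.trans hj.2⟩
    · filter_upwards [Ico_mem_nhdsGE hi.2] with x hx
      exact hτe i x ⟨hi.1.trans hx.1, hx.2.le⟩
  · intro s
    rw [← hasDerivWithinAt_univ, ← Iic_union_Ici (a := s)]
    obtain ⟨j, hj⟩ := hc.exists_mem_Ioc h hn he s
    obtain ⟨i, hi⟩ := hc.exists_mem_Ico h hn he s
    refine HasDerivWithinAt.union ?_ ?_
    · rw [hτe j s (Ioc_subset_Icc_self hj)]
      refine (hasDerivAt_piece h s (c j) (a j)).hasDerivWithinAt.congr_of_eventuallyEq ?_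
        (hc.eq_shift_Icc (Ioc_subset_Icc_self hj))
      filter_upwards [Ioc_mem_nhdsLE hj.1] with x hx
      exact hc.eq_shift_Icc ⟨hx.1.le, hx.2.trans hj.2⟩
    · rw [hτe i s (Ico_subset_Icc_self hi)]
      refine (hasDerivAt_piece h s (c i) (a i)).hasDerivWithinAt.congr_of_eventuallyEq ?_
        (hc.eq_shift_Icc (Ico_subset_Icc_self hi))
      filter_upwards [Ico_mem_nhdsGE hi.2] with x hx
      exact hc.eq_shift_Icc ⟨hi.1.trans hx.1, hx.2.le⟩

lemma periodic_of_periodic (hc : IsArcChain κ κ' e a b c κW) (h : IsSignaturePair κ κ') {n : ℤ}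
    (hn : 0 < n) (he : Function.Periodic e n) {d : ℤ} (hd : Function.Periodic e d) :
    Function.Periodic κW (c d) := by
  intro s
  obtain ⟨j, hj⟩ := hc.exists_mem_Ico h hn he s
  have h1 := hc.add_period h hd j
  have h2 := hc.add_period h hd (j + 1)
  have e1 : j + 1 + d = j + d + 1 := by ring
  rw [e1] at h2
  rw [hc.eq_shift j s hj, hc.eq_shift (j + d) (s + c d) ⟨by linarith [hj.1], by linarith [hj.2]⟩]
  have harc := hc.arc (j + d)
  rw [hd j] at harc
  have h3 := ((hc.arc j).eq_shift h harc).2 (s - c j)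
    ⟨by linarith [hj.1], by linarith [hj.2, hc.succ j]⟩
  have h4 := congrArg Prod.fst h3
  have e2 : s + c d - c (j + d) + a (j + d) = a (j + d) + (s - c j) := by rw [h1]; ring
  rw [e2, add_comm (s - c j)]
  exact h4.symm

section Signature

variable {τ : ℝ → ℝ}

lemma mem_edge (hc : IsArcChain κ κ' e a b c κW)
    (hσ : ∀ j, ∀ s ∈ Icc (c j) (c (j + 1)), sigPair κW τ s = sigPair κ κ' (s - c j + a j))
    {j : ℤ} {s : ℝ} (hs : s ∈ Ioo (c j) (c (j + 1))) : sigPair κW τ s ∈ (e j).1 := by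
  rw [hσ j s (Ioo_subset_Icc_self hs)]
  exact (hc.arc j).mapsTo ⟨by linarith [hs.1], by linarith [hs.2, hc.shift_right j]⟩

lemma breakpoint_not_simple (hc : IsArcChain κ κ' e a b c κW) (h : IsSignaturePair κ κ')
    (hσ : ∀ j, ∀ s ∈ Icc (c j) (c (j + 1)), sigPair κW τ s = sigPair κ κ' (s - c j + a j))
    (j : ℤ) : ¬ IsSimplePoint (range (sigPair κ κ')) (sigPair κW τ (c j)) := by
  rw [hσ j (c j) ⟨le_rfl, (hc.lt_succ j).le⟩, sub_self, zero_add]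
  exact (hc.arc j).left_notMem h

/-- The periods of `κW` are the breakpoints of the periods of the word of edges. -/
lemma exists_period (hc : IsArcChain κ κ' e a b c κW) (h : IsSignaturePair κ κ') {n : ℤ}
    (hn : 0 < n) (he : Function.Periodic e n)
    (hσ : ∀ j, ∀ s ∈ Icc (c j) (c (j + 1)), sigPair κW τ s = sigPair κ κ' (s - c j + a j))
    {p : ℝ} (hp : Function.Periodic (sigPair κW τ) p) :
    ∃ d, c d = p ∧ Function.Periodic e d := by
  have hbreak : ∀ s, ¬ IsSimplePoint (range (sigPair κ κ')) (sigPair κW τ s) → ∃ j, c j = s := by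
    intro s hs
    obtain ⟨j, hj⟩ := hc.exists_mem_Ico h hn he s
    rcases hj.1.lt_or_eq with h1 | h1
    · exact absurd ((e j).isSimplePoint (hc.mem_edge hσ ⟨h1, hj.2⟩)) hs
    · exact ⟨j, h1⟩
  -- The breakpoint `0` lies over a non-simple point, and `p` lies over the same point, so `p` is a
  -- breakpoint too.
  obtain ⟨d, hd⟩ : ∃ d, c d = p := by
    apply hbreak
    have := hp 0
    rw [zero_add] at this
    rw [this, ← hc.zero]
    exact hc.breakpoint_not_simple h hσ 0
  refine ⟨d, hd, ?_⟩
  have hedge : ∀ j i x, x ∈ Ioo (c j) (c (j + 1)) → x + p ∈ Ioo (c i) (c (i + 1)) →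
      e i = e j := by
    intro j i x hx hxp
    have h1 := hc.mem_edge hσ hx
    have h2 := hc.mem_edge hσ hxp
    rw [hp x] at h2
    exact QuiverEdge.eq_of_mem h2 h1
  -- Once two pieces are aligned at one end, they overlap after the shift by `p`. A common interior
  -- point identifies their edges, so their lengths agree and the other ends are aligned as well.
  have key : ∀ j : ℤ, c (j + d) = c j + p := by
    intro j
    induction j using Int.induction_on with
    | zero => rw [zero_add, hd, hc.zero, zero_add]
    | succ i ih =>
      have h1 := hc.lt_succ i
      have h2 := hc.lt_succ (i + d)
      obtain ⟨x, hx1, hx2⟩ := exists_between (lt_min h1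
        (show c i < c (i + d + 1) - p by linarith))
      have := hc.length_eq h (hedge i (i + d) x ⟨hx1, hx2.trans_le (min_le_left _ _)⟩
        ⟨by linarith, by linarith [hx2.trans_le (min_le_right _ _)]⟩)
      have e1 : (i : ℤ) + 1 + d = i + d + 1 := by ring
      rw [e1, hc.succ, hc.succ, ih, this]
      ring
    | pred i ih =>
      have e1 : -(i : ℤ) - 1 + 1 = -i := by ring
      have e2 : -(i : ℤ) - 1 + d + 1 = -i + d := by ring
      have h1 := hc.lt_succ (-(i : ℤ) - 1)
      have h2 := hc.lt_succ (-(i : ℤ) - 1 + d)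
      rw [e1] at h1
      rw [e2] at h2
      obtain ⟨x, hx1, hx2⟩ := exists_between (max_lt h1
        (show c (-(i : ℤ) - 1 + d) - p < c (-i) by linarith))
      have := hc.length_eq h (hedge (-(i : ℤ) - 1) (-(i : ℤ) - 1 + d) x
        ⟨(le_max_left _ _).trans_lt hx1, by rwa [e1]⟩
        ⟨by linarith [(le_max_right _ _).trans_lt hx1], by rw [e2]; linarith⟩)
      have h3 := hc.succ (-(i : ℤ) - 1)
      have h4 := hc.succ (-(i : ℤ) - 1 + d)
      rw [e1] at h3
      rw [e2] at h4
      linarith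
  intro j
  obtain ⟨x, hx1, hx2⟩ := exists_between (hc.lt_succ j)
  have h1 := key (j + 1)
  have e1 : j + 1 + d = j + d + 1 := by ring
  rw [e1] at h1
  exact hedge j (j + d) x ⟨hx1, hx2⟩ ⟨by linarith [key j], by linarith⟩

/-- Each occurrence of the edge contributes the parameter with the same offset as `u`. Here `u` may
be a breakpoint, whose fibre can be larger. -/
lemma encard_le_encard_fiber (hc : IsArcChain κ κ' e a b c κW) (h : IsSignaturePair κ κ')
    {n : ℤ} (hσ : ∀ j, ∀ s ∈ Icc (c j) (c (j + 1)),
      sigPair κW τ s = sigPair κ κ' (s - c j + a j))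
    {j : ℤ} {u : ℝ} (hu : u ∈ Ico (c j) (c (j + 1))) :
    {r : ℤ | 0 ≤ r ∧ r < n ∧ e r = e j}.encard ≤
      {s | s ∈ Ico 0 (c n) ∧ sigPair κW τ s = sigPair κW τ u}.encard := by
  have hinj : Function.Injective fun r => c r + (u - c j) := fun r r' hr =>
    hc.strictMono.injective (by simpa using hr)
  rw [← hinj.encard_image]
  apply encard_le_encard
  rintro _ ⟨r, ⟨h0, h1, h2⟩, rfl⟩
  have hlen := hc.length_eq h h2
  have hr1 : c r + (u - c j) < c (r + 1) := by
    rw [hc.succ, hlen]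
    linarith [hu.2, hc.succ j]
  have hr0 : c r ≤ c r + (u - c j) := by linarith [hu.1]
  refine ⟨⟨?_, ?_⟩, ?_⟩
  · have := hc.strictMono.monotone h0
    rw [hc.zero] at this
    linarith
  · have := hc.strictMono.monotone (show r + 1 ≤ n by omega)
    exact hr1.trans_le this
  · simp only
    rw [hσ r _ ⟨hr0, hr1.le⟩, hσ j u ⟨hu.1, hu.2.le⟩]
    have harc := hc.arc r
    rw [h2] at harc
    have := (harc.eq_shift h (hc.arc j)).2 (u - c j)
      ⟨by linarith [hu.1], by linarith [hu.2, hc.succ j]⟩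
    have e1 : c r + (u - c j) - c r + a r = a r + (u - c j) := by ring
    rw [e1, this, add_comm]

/-- Over an interior point of an edge, only occurrences of that edge can meet the fibre, and
injectivity on an arc fixes the offset. -/
lemma encard_fiber_le (hc : IsArcChain κ κ' e a b c κW) (h : IsSignaturePair κ κ') {n : ℤ}
    (hn : 0 < n) (he : Function.Periodic e n)
    (hσ : ∀ j, ∀ s ∈ Icc (c j) (c (j + 1)), sigPair κW τ s = sigPair κ κ' (s - c j + a j))
    {j : ℤ} {u : ℝ} (hu : u ∈ Ioo (c j) (c (j + 1))) :
    {s | s ∈ Ico 0 (c n) ∧ sigPair κW τ s = sigPair κW τ u}.encard ≤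
      {r : ℤ | 0 ≤ r ∧ r < n ∧ e r = e j}.encard := by
  have hinj : Function.Injective fun r => c r + (u - c j) := fun r r' hr =>
    hc.strictMono.injective (by simpa using hr)
  rw [← hinj.encard_image {r : ℤ | 0 ≤ r ∧ r < n ∧ e r = e j}]
  apply encard_le_encard
  rintro s ⟨hs, hsu⟩
  obtain ⟨r, hr⟩ := hc.exists_mem_Ico h hn he s
  have huj := hc.mem_edge hσ hu
  have hr1 : c r < s := by
    refine lt_of_le_of_ne hr.1 fun heq => ?_
    refine hc.breakpoint_not_simple h hσ r ?_
    rw [heq, hsu]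
    exact (e j).isSimplePoint huj
  have hre : e r = e j := by
    refine QuiverEdge.eq_of_mem (hc.mem_edge hσ ⟨hr1, hr.2⟩) ?_
    rw [hsu]
    exact huj
  refine ⟨r, ⟨?_, ?_, hre⟩, ?_⟩
  · have := hc.strictMono.lt_iff_lt.1 (show c 0 < c (r + 1) by
      rw [hc.zero]; exact hs.1.trans_lt hr.2)
    omega
  · exact hc.strictMono.lt_iff_lt.1 (hr.1.trans_lt hs.2)
  · have harc := hc.arc r
    rw [hre] at harc
    have hlen := hc.length_eq h hre
    have h1 := (harc.eq_shift h (hc.arc j)).2 (s - c r)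
      ⟨by linarith, by linarith [hr.2, hc.succ r]⟩
    rw [hσ r s ⟨hr1.le, hr.2.le⟩, hσ j u (Ioo_subset_Icc_self hu), add_comm, h1] at hsu
    have := (hc.arc j).injOn h ⟨by linarith, by linarith [hr.2, hc.succ r]⟩
      ⟨by linarith [hu.1], by linarith [hu.2, hc.succ j]⟩ hsu
    linarith

lemma iInf_encard_fiber (hc : IsArcChain κ κ' e a b c κW) (h : IsSignaturePair κ κ') {n : ℤ}
    (hn : 0 < n) (he : Function.Periodic e n)
    (hσ : ∀ j, ∀ s ∈ Icc (c j) (c (j + 1)), sigPair κW τ s = sigPair κ κ' (s - c j + a j)) :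
    ⨅ ζ ∈ range (sigPair κW τ), {s | s ∈ Ico 0 (c n) ∧ sigPair κW τ s = ζ}.encard =
      ⨅ j : ℤ, {r : ℤ | 0 ≤ r ∧ r < n ∧ e r = e j}.encard := by
  apply le_antisymm
  · refine le_iInf fun j => ?_
    obtain ⟨u, hu⟩ := exists_between (hc.lt_succ j)
    exact (iInf₂_le _ (mem_range_self u)).trans (hc.encard_fiber_le h hn he hσ hu)
  · refine le_iInf₂ ?_
    rintro _ ⟨u, rfl⟩
    obtain ⟨j, hj⟩ := hc.exists_mem_Ico h hn he u
    exact (iInf_le _ j).trans (hc.encard_le_encard_fiber h hσ hj)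

end Signature

lemma integral_eq_sum (hc : IsArcChain κ κ' e a b c κW) (hκ : Continuous κW) (n : ℕ) :
    ∫ s in (0 : ℝ)..c n, κW s = ∑ r ∈ Finset.range n, ∫ s in (a r)..(b r), κ s := by
  have h0 : (0 : ℝ) = c ((0 : ℕ) : ℤ) := by rw [Nat.cast_zero, hc.zero]
  rw [h0, ← intervalIntegral.sum_integral_adjacent_intervals (a := fun r : ℕ => c r)
    fun k _ => hκ.intervalIntegrable _ _]
  refine Finset.sum_congr rfl fun r _ => ?_
  have hcong : ∫ s in c r..c ((r + 1 : ℕ) : ℤ), κW s =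
      ∫ s in c r..c ((r : ℤ) + 1), κ (s - (c r - a r)) := by
    push_cast
    refine intervalIntegral.integral_congr fun s hs => ?_
    rw [uIcc_of_le (hc.lt_succ r).le] at hs
    rw [hc.eq_shift_Icc hs]
    congr 1
    ring
  rw [hcong, intervalIntegral.integral_comp_sub_right (fun s => κ s)]
  congr 1
  · ring
  · rw [hc.succ]; ring

end IsArcChain

/-! ### Plane curves with prescribed curvature -/

section CurveOfCurvature

/-- The tangent angle of `curveOfCurvature κ`. -/
noncomputable def tangentAngle (κ : ℝ → ℝ) (s : ℝ) : ℝ := ∫ x in (0 : ℝ)..s, κ x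

/-- The unit tangent vector of `curveOfCurvature κ`. -/
noncomputable def unitTangent (κ : ℝ → ℝ) (s : ℝ) : ℂ := Complex.exp ((tangentAngle κ s : ℂ) * Complex.I)

variable {κ : ℝ → ℝ}

lemma tangentAngle_zero : tangentAngle κ 0 = 0 := by simp [tangentAngle]

lemma unitTangent_zero : unitTangent κ 0 = 1 := by simp [unitTangent, tangentAngle_zero]

lemma curveOfCurvature_zero : curveOfCurvature κ 0 = 0 := by simp [curveOfCurvature]

lemma norm_unitTangent (s : ℝ) : ‖unitTangent κ s‖ = 1 := Complex.norm_exp_ofReal_mul_I _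

lemma hasDerivAt_tangentAngle (hκ : Continuous κ) (s : ℝ) :
    HasDerivAt (tangentAngle κ) (κ s) s :=
  intervalIntegral.integral_hasDerivAt_right (hκ.intervalIntegrable _ _)
    (hκ.stronglyMeasurableAtFilter _ _) hκ.continuousAt

lemma continuous_tangentAngle (hκ : Continuous κ) : Continuous (tangentAngle κ) :=
  continuous_iff_continuousAt.2 fun s => (hasDerivAt_tangentAngle hκ s).continuousAt

lemma hasDerivAt_unitTangent (hκ : Continuous κ) (s : ℝ) :
    HasDerivAt (unitTangent κ) (unitTangent κ s * (κ s * Complex.I)) s :=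
  ((hasDerivAt_tangentAngle hκ s).ofReal_comp.mul_const Complex.I).cexp

lemma continuous_unitTangent (hκ : Continuous κ) : Continuous (unitTangent κ) :=
  continuous_iff_continuousAt.2 fun s => (hasDerivAt_unitTangent hκ s).continuousAt

lemma hasDerivAt_curveOfCurvature (hκ : Continuous κ) (s : ℝ) :
    HasDerivAt (curveOfCurvature κ) (unitTangent κ s) s :=
  intervalIntegral.integral_hasDerivAt_right
    ((continuous_unitTangent hκ).intervalIntegrable _ _)
    ((continuous_unitTangent hκ).stronglyMeasurableAtFilter _ _) (continuous_unitTangent hκ).continuousAt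

lemma deriv_curveOfCurvature (hκ : Continuous κ) :
    deriv (curveOfCurvature κ) = unitTangent κ :=
  funext fun s => (hasDerivAt_curveOfCurvature hκ s).deriv

lemma contDiff_curveOfCurvature (hκ : ContDiff ℝ 1 κ) : ContDiff ℝ 3 (curveOfCurvature κ) := by
  have hc := hκ.continuous
  have h1 : ContDiff ℝ 2 (tangentAngle κ) := by
    have : (2 : WithTop ℕ∞) = 1 + 1 := by norm_num
    rw [this, contDiff_succ_iff_deriv]
    refine ⟨fun s => (hasDerivAt_tangentAngle hc s).differentiableAt, by simp, ?_⟩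
    rwa [funext fun s => (hasDerivAt_tangentAngle hc s).deriv]
  have h2 : ContDiff ℝ 2 (unitTangent κ) :=
    ((Complex.ofRealCLM.contDiff.comp h1).mul contDiff_const).cexp
  have : (3 : WithTop ℕ∞) = 2 + 1 := by norm_num
  rw [this, contDiff_succ_iff_deriv, deriv_curveOfCurvature hc]
  exact ⟨fun s => (hasDerivAt_curveOfCurvature hc s).differentiableAt, by simp, h2⟩

lemma curvature_curveOfCurvature (hκ : Continuous κ) : curvature (curveOfCurvature κ) = κ := by
  funext s
  unfold curvature
  rw [deriv_curveOfCurvature hκ, (hasDerivAt_unitTangent hκ s).deriv, norm_unitTangent]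
  have h := norm_unitTangent (κ := κ) s
  have h2 : (unitTangent κ s).re * (unitTangent κ s).re +
      (unitTangent κ s).im * (unitTangent κ s).im = 1 := by
    rw [← Complex.normSq_apply, Complex.normSq_eq_norm_sq, h, one_pow]
  simp only [Complex.mul_re, Complex.mul_im, Complex.ofReal_re, Complex.ofReal_im, Complex.I_re,
    Complex.I_im]
  linear_combination κ s * h2

lemma hasTurningNumber_curveOfCurvature (hκ : Continuous κ) {L : ℝ} {ξ : ℤ}
    (h : tangentAngle κ L = 2 * Real.pi * ξ) :
    HasTurningNumber (curveOfCurvature κ) L ξ := by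
  refine ⟨tangentAngle κ, continuous_tangentAngle hκ, fun s => ?_, ?_⟩
  · rw [deriv_curveOfCurvature hκ, norm_unitTangent, Complex.ofReal_one, one_mul, unitTangent]
  · rw [tangentAngle_zero, sub_zero, h]

lemma tangentAngle_add (hκ : Continuous κ) {p : ℝ} (hp : Function.Periodic κ p) (s : ℝ) :
    tangentAngle κ (s + p) = tangentAngle κ p + tangentAngle κ s := by
  unfold tangentAngle
  rw [← intervalIntegral.integral_add_adjacent_intervals (hκ.intervalIntegrable 0 p)
    (hκ.intervalIntegrable p (s + p))]
  congr 1
  have := intervalIntegral.integral_comp_add_right (a := 0) (b := s) (fun x => κ x) p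
  rw [zero_add] at this
  rw [← this]
  exact intervalIntegral.integral_congr fun x _ => hp x

lemma unitTangent_add (hκ : Continuous κ) {p : ℝ} (hp : Function.Periodic κ p) (s : ℝ) :
    unitTangent κ (s + p) = unitTangent κ p * unitTangent κ s := by
  unfold unitTangent
  rw [tangentAngle_add hκ hp, ← Complex.exp_add]
  push_cast
  ring_nf

/-- A period of `κ` adds a constant to the tangent angle, hence rotates the tangent; integrating
turns the parameter shift into a rigid motion. -/
lemma curveOfCurvature_add (hκ : Continuous κ) {p : ℝ} (hp : Function.Periodic κ p) (s : ℝ) :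
    curveOfCurvature κ (s + p) =
      unitTangent κ p * curveOfCurvature κ s + curveOfCurvature κ p := by
  have hT := continuous_unitTangent hκ
  change ∫ x in (0 : ℝ)..(s + p), unitTangent κ x =
    unitTangent κ p * (∫ x in (0 : ℝ)..s, unitTangent κ x) + ∫ x in (0 : ℝ)..p, unitTangent κ x
  rw [← intervalIntegral.integral_add_adjacent_intervals (hT.intervalIntegrable 0 p)
    (hT.intervalIntegrable p (s + p)), add_comm]
  congr 1
  have := intervalIntegral.integral_comp_add_right (a := 0) (b := s) (fun x => unitTangent κ x) p
  rw [zero_add] at this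
  rw [← this, ← intervalIntegral.integral_const_mul]
  exact intervalIntegral.integral_congr fun x _ => unitTangent_add hκ hp x

/-- Converse of `curveOfCurvature_add`: differentiating twice recovers the curvature, and the
initial point `0` and initial tangent `1` determine the motion. -/
lemma periodic_of_se2Act (hκ : Continuous κ) {g : Circle × ℂ} {c : ℝ}
    (h : ∀ s, se2Act g (curveOfCurvature κ s) = curveOfCurvature κ (s + c)) :
    Function.Periodic κ c ∧ (g.1 : ℂ) = unitTangent κ c ∧ g.2 = curveOfCurvature κ c := by
  have h1 : ∀ s, (g.1 : ℂ) * unitTangent κ s = unitTangent κ (s + c) := by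
    intro s
    have e1 := ((hasDerivAt_curveOfCurvature hκ s).const_mul (g.1 : ℂ)).add_const g.2
    have e2 := (hasDerivAt_curveOfCurvature hκ (s + c)).comp_add_const s c
    rw [← funext h] at e2
    exact e1.unique e2
  refine ⟨fun s => ?_, ?_, ?_⟩
  · have e1 := (hasDerivAt_unitTangent hκ s).const_mul (g.1 : ℂ)
    have e2 := (hasDerivAt_unitTangent hκ (s + c)).comp_add_const s c
    rw [← funext h1] at e2
    have e3 := e1.unique e2
    rw [← h1, ← mul_assoc] at e3
    have hne : (g.1 : ℂ) * unitTangent κ s ≠ 0 :=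
      mul_ne_zero (Circle.coe_ne_zero _) (Complex.exp_ne_zero _)
    have e4 := mul_right_cancel₀ Complex.I_ne_zero (mul_left_cancel₀ hne e3)
    exact_mod_cast e4.symm
  · have := h1 0
    rwa [unitTangent_zero, mul_one, zero_add] at this
  · have := h 0
    rwa [curveOfCurvature_zero, zero_add, se2Act, mul_zero, zero_add] at this

end CurveOfCurvature

/-- A continuous function with set of periods `ℤℓ` whose integral over `[0, mℓ]` is `2πξ`, where
`m > 1` is coprime to `ξ`. -/
structure IsSymmetricCurvature (κ : ℝ → ℝ) (ℓ : ℝ) (m : ℕ) (ξ : ℤ) : Prop where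
  continuous : Continuous κ
  pos : 0 < ℓ
  periodic_iff : ∀ p, Function.Periodic κ p ↔ ∃ k : ℤ, p = k * ℓ
  one_lt : 1 < m
  coprime : IsCoprime (m : ℤ) ξ
  angle : tangentAngle κ (m * ℓ) = 2 * Real.pi * ξ

/-! ### Closure and symmetries of the induced curve -/

namespace IsSymmetricCurvature

variable {κ : ℝ → ℝ} {ℓ : ℝ} {m : ℕ} {ξ : ℤ}

lemma periodic_int_mul (h : IsSymmetricCurvature κ ℓ m ξ) (k : ℤ) :
    Function.Periodic κ (k * ℓ) := (h.periodic_iff _).2 ⟨k, rfl⟩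

lemma period_pos (h : IsSymmetricCurvature κ ℓ m ξ) : 0 < (m : ℝ) * ℓ :=
  mul_pos (by exact_mod_cast (zero_lt_one.trans h.one_lt)) h.pos

lemma tangentAngle_int_mul (h : IsSymmetricCurvature κ ℓ m ξ) (k : ℤ) :
    tangentAngle κ (k * ℓ) = k * tangentAngle κ ℓ := by
  have hp : Function.Periodic κ ℓ := by simpa using h.periodic_int_mul 1
  have hadd := tangentAngle_add h.continuous hp
  induction k using Int.induction_on with
  | zero => simp [tangentAngle_zero]
  | succ i ih =>
    have := hadd ((i : ℤ) * ℓ)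
    rw [ih] at this
    push_cast at this ⊢
    rw [add_mul, one_mul, this]
    ring
  | pred i ih =>
    have := hadd (((-(i : ℤ) - 1 : ℤ) : ℝ) * ℓ)
    have e1 : ((-(i : ℤ) - 1 : ℤ) : ℝ) * ℓ + ℓ = ((-(i : ℤ) : ℤ) : ℝ) * ℓ := by push_cast; ring
    rw [e1, ih] at this
    push_cast at this ⊢
    linarith

/-- The tangent turns by `2πξ/m` over `ℓ`, so the condition reads `m ∣ k ξ`, and coprimality removes
`ξ`. -/
lemma unitTangent_eq_one_iff (h : IsSymmetricCurvature κ ℓ m ξ) (k : ℤ) :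
    unitTangent κ (k * ℓ) = 1 ↔ (m : ℤ) ∣ k := by
  have hm : (m : ℝ) ≠ 0 := by
    have := h.one_lt
    positivity
  have hang : (m : ℝ) * tangentAngle κ ℓ = 2 * Real.pi * ξ := by
    have := h.tangentAngle_int_mul m
    push_cast at this
    rw [← this, h.angle]
  have hpi := Real.pi_ne_zero
  have hk : ∀ n : ℤ, tangentAngle κ (k * ℓ) = n * (2 * Real.pi) ↔ k * ξ = m * n := by
    intro n
    rw [h.tangentAngle_int_mul]
    rw [← mul_right_inj' hm]
    have e : (m : ℝ) * (k * tangentAngle κ ℓ) = (2 * Real.pi) * (k * ξ) := by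
      linear_combination (k : ℝ) * hang
    have e2 : (m : ℝ) * (n * (2 * Real.pi)) = (2 * Real.pi) * (m * n) := by ring
    rw [e, e2, mul_right_inj' (by positivity)]
    exact_mod_cast Iff.rfl
  unfold unitTangent
  rw [Complex.exp_eq_one_iff]
  constructor
  · rintro ⟨n, hn⟩
    have : tangentAngle κ (k * ℓ) = n * (2 * Real.pi) := by
      rw [← mul_assoc] at hn
      have := mul_right_cancel₀ Complex.I_ne_zero hn
      exact_mod_cast this
    exact h.coprime.dvd_of_dvd_mul_right ⟨n, (hk n).1 this⟩
  · rintro ⟨q, rfl⟩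
    refine ⟨q * ξ, ?_⟩
    rw [(hk (q * ξ)).2 (by ring)]
    push_cast
    ring

lemma curve_periodic (h : IsSymmetricCurvature κ ℓ m ξ) :
    Function.Periodic (curveOfCurvature κ) (m * ℓ) := by
  have hT : unitTangent κ (m * ℓ) = 1 := by
    have := (h.unitTangent_eq_one_iff m).2 dvd_rfl
    exact_mod_cast this
  have hT1 : unitTangent κ ℓ ≠ 1 := by
    intro h1
    have h2 := (h.unitTangent_eq_one_iff 1).1 (by simpa using h1)
    have := Int.le_of_dvd one_pos h2
    have := h.one_lt
    omega
  have hp1 : Function.Periodic κ ℓ := by simpa using h.periodic_int_mul 1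
  have hpm : Function.Periodic κ (m * ℓ) := by simpa using h.periodic_int_mul m
  -- The shifts by `ℓ` and by `m ℓ` commute. The second is a translation, so its vector is fixed by
  -- the nontrivial rotation part of the first and must vanish.
  have h0 : curveOfCurvature κ (m * ℓ) = 0 := by
    have e1 := curveOfCurvature_add h.continuous hp1 (m * ℓ)
    have e2 := curveOfCurvature_add h.continuous hpm ℓ
    rw [add_comm ℓ, e1, hT] at e2
    have e3 : (unitTangent κ ℓ - 1) * curveOfCurvature κ (m * ℓ) = 0 := by
      linear_combination e2
    exact (mul_eq_zero.1 e3).resolve_left (sub_ne_zero.2 hT1)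
  intro s
  rw [curveOfCurvature_add h.continuous hpm, hT, h0, one_mul, add_zero]

lemma exists_of_curve_periodic (h : IsSymmetricCurvature κ ℓ m ξ) {p : ℝ}
    (hp : Function.Periodic (curveOfCurvature κ) p) : ∃ k : ℤ, p = k * (m * ℓ) := by
  obtain ⟨h1, h2, -⟩ := periodic_of_se2Act h.continuous (g := (1, 0)) (c := p) fun s => by
    rw [hp s]; simp [se2Act]
  obtain ⟨k, rfl⟩ := (h.periodic_iff p).1 h1
  obtain ⟨q, rfl⟩ := (h.unitTangent_eq_one_iff k).1 (by simpa using h2.symm)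
  exact ⟨q, by push_cast; ring⟩

lemma isClosedCurve (h : IsSymmetricCurvature κ ℓ m ξ) (hκ : ContDiff ℝ 1 κ) :
    IsClosedCurve (curveOfCurvature κ) (m * ℓ) := by
  refine ⟨contDiff_curveOfCurvature hκ, fun s => ?_, ⟨h.period_pos, h.curve_periodic⟩, ?_⟩
  · rw [deriv_curveOfCurvature h.continuous, norm_unitTangent]
  · rintro p ⟨hp0, hp⟩
    obtain ⟨k, rfl⟩ := h.exists_of_curve_periodic hp
    have hk : (0 : ℝ) < k := (pos_iff_pos_of_mul_pos hp0).2 h.period_pos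
    have : (1 : ℝ) ≤ k := by exact_mod_cast (show (0 : ℤ) < k by exact_mod_cast hk)
    exact le_mul_of_one_le_left h.period_pos.le this

lemma paramSymIndex_eq (h : IsSymmetricCurvature κ ℓ m ξ) :
    paramSymIndex (curveOfCurvature κ) = m := by
  have hset : {g : Circle × ℂ | ∃ c : ℝ, ∀ s,
      se2Act g (curveOfCurvature κ s) = curveOfCurvature κ (s + c)} =
      (fun k : ℤ => (Circle.exp (tangentAngle κ (k * ℓ)), curveOfCurvature κ (k * ℓ))) ''
        Ico 0 (m : ℤ) := by
    ext g
    constructor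
    · rintro ⟨c, hc⟩
      obtain ⟨h1, -, -⟩ := periodic_of_se2Act h.continuous hc
      obtain ⟨k, rfl⟩ := (h.periodic_iff c).1 h1
      have hm : (0 : ℤ) < m := by have := h.one_lt; omega
      -- The curve has period `m ℓ`, so the shift only matters modulo `m`.
      have hc' : ∀ s, se2Act g (curveOfCurvature κ s) =
          curveOfCurvature κ (s + (k % m : ℤ) * ℓ) := by
        intro s
        rw [hc s, ← (h.curve_periodic.int_mul (k / m)) (s + (k % m : ℤ) * ℓ)]
        congr 1
        have := Int.emod_add_mul_ediv k m
        have e : (k : ℝ) = ((k % m : ℤ) : ℝ) + m * ((k / m : ℤ) : ℝ) := by exact_mod_cast this.symm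
        rw [e]
        ring
      obtain ⟨-, h2, h3⟩ := periodic_of_se2Act h.continuous hc'
      refine ⟨k % m, ⟨Int.emod_nonneg _ hm.ne', Int.emod_lt_of_pos _ hm⟩, ?_⟩
      refine Prod.ext (Circle.ext ?_) h3.symm
      rw [h2, Circle.coe_exp, unitTangent]
    · rintro ⟨k, -, rfl⟩
      refine ⟨k * ℓ, fun s => ?_⟩
      rw [curveOfCurvature_add h.continuous (h.periodic_int_mul k), se2Act, Circle.coe_exp,
        unitTangent]
  have hinj : InjOn (fun k : ℤ => (Circle.exp (tangentAngle κ (k * ℓ)),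
      curveOfCurvature κ (k * ℓ))) (Ico 0 (m : ℤ)) := by
    intro k hk k' hk' hkk
    -- The rotation parts alone already separate the `m` symmetries.
    have h1 : unitTangent κ (k * ℓ) = unitTangent κ (k' * ℓ) := by
      have := congrArg (fun g : Circle × ℂ => (g.1 : ℂ)) hkk
      simpa only [Circle.coe_exp, unitTangent] using this
    have h2 := unitTangent_add h.continuous (h.periodic_int_mul k') (((k - k' : ℤ) : ℝ) * ℓ)
    have e : ((k - k' : ℤ) : ℝ) * ℓ + k' * ℓ = k * ℓ := by push_cast; ring
    have hne : unitTangent κ (k' * ℓ) ≠ 0 := Complex.exp_ne_zero _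
    rw [e, h1, left_eq_mul₀ hne] at h2
    have h3 := (h.unitTangent_eq_one_iff _).1 h2
    have h4 : |k - k'| < m := by
      rw [abs_lt]
      constructor <;> linarith [hk.1, hk.2, hk'.1, hk'.2]
    have := Int.eq_zero_of_abs_lt_dvd h3 h4
    omega
  unfold paramSymIndex
  rw [hset, hinj.encard_image]
  rw [← Finset.coe_Ico, encard_coe_eq_coe_finsetCard, Int.card_Ico]
  simp

end IsSymmetricCurvature

/-- A continuously differentiable unit speed curve with derivative `α'`. -/
structure IsUnitSpeed (α α' : ℝ → ℂ) : Prop where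
  hasDerivAt : ∀ s, HasDerivAt α (α' s) s
  continuous_deriv : Continuous α'
  norm_eq_one : ∀ s, ‖α' s‖ = 1

/-! ### Unit speed curves in simple sets -/

namespace IsUnitSpeed

variable {α α' β β' : ℝ → ℂ} {Γ : Set ℂ}

lemma continuous (h : IsUnitSpeed α α') : Continuous α :=
  continuous_iff_continuousAt.2 fun s => (h.hasDerivAt s).continuousAt

/-- The component of `z` in the direction `v`. -/
noncomputable def component (v z : ℂ) : ℝ := (starRingEnd ℂ v * z).re

lemma hasDerivAt_component (h : IsUnitSpeed α α') (v : ℂ) (s : ℝ) :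
    HasDerivAt (fun s => component v (α s)) (component v (α' s)) s :=
  Complex.reCLM.hasFDerivAt.comp_hasDerivAt s ((h.hasDerivAt s).const_mul (starRingEnd ℂ v))

lemma continuous_component (h : IsUnitSpeed α α') (v : ℂ) :
    Continuous fun s => component v (α' s) :=
  Complex.continuous_re.comp (continuous_const.mul h.continuous_deriv)

lemma component_self (h : IsUnitSpeed α α') (t : ℝ) : component (α' t) (α' t) = 1 := by
  rw [component, Complex.conj_mul', h.norm_eq_one]
  simp

/-- Projection onto the tangent direction at `t` is thus a scalar coordinate along the curve near
`t`; it yields local injectivity and the differentiability of reparametrizations. -/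
lemma exists_component_pos (h : IsUnitSpeed α α') (t : ℝ) :
    ∃ δ > 0, ∀ s ∈ Icc (t - δ) (t + δ), 0 < component (α' t) (α' s) := by
  have hev : ∀ᶠ s in 𝓝 t, 0 < component (α' t) (α' s) :=
    (h.continuous_component (α' t)).continuousAt.eventually_const_lt
      (one_pos.trans_eq (h.component_self t).symm)
  obtain ⟨ε, hε, hb⟩ := Metric.mem_nhds_iff.1 hev
  refine ⟨ε / 2, by linarith, fun s hs => hb ?_⟩
  rw [Metric.mem_ball, Real.dist_eq, abs_lt]
  constructor <;> linarith [hs.1, hs.2]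

lemma injOn_of_component_pos (h : IsUnitSpeed α α') {t δ : ℝ}
    (hpos : ∀ s ∈ Icc (t - δ) (t + δ), 0 < component (α' t) (α' s)) :
    InjOn α (Icc (t - δ) (t + δ)) := by
  have hm : StrictMonoOn (fun s => component (α' t) (α s)) (Icc (t - δ) (t + δ)) := by
    refine strictMonoOn_of_deriv_pos (convex_Icc _ _)
      (continuous_iff_continuousAt.2 fun s => (h.hasDerivAt_component _ s).continuousAt).continuousOn
      fun s hs => ?_
    rw [(h.hasDerivAt_component _ s).deriv]
    exact hpos s (interior_subset hs)
  intro x hx y hy hxy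
  exact hm.injOn hx hy (congrArg (component (α' t)) hxy)

/-- Two unit speed curves in `Γ` through a simple point agree near this point, up to a shift and a
reflection of the parameter. -/
lemma eventually_eq_or (hα : IsUnitSpeed α α') (hαΓ : ∀ s, α s ∈ Γ) (hβ : IsUnitSpeed β β')
    (hβΓ : ∀ s, β s ∈ Γ) {t t' : ℝ} (hp : IsSimplePoint Γ (β t')) (htt : α t = β t') :
    (∀ᶠ s in 𝓝 (0 : ℝ), α (t + s) = β (t' + s)) ∨
      (∀ᶠ s in 𝓝 (0 : ℝ), α (t + s) = β (t' - s)) := by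
  obtain ⟨δ, hδ, hpos⟩ := hβ.exists_component_pos t'
  obtain ⟨φ, ε, hε, hφt, hφc, hφ⟩ := exists_local_reparametrization hα.continuous hαΓ
    hβ.continuous hβΓ hδ (hβ.injOn_of_component_pos hpos) hp htt
  set J := Ioo (t - ε) (t + ε) with hJ
  -- This is the derivative of `φ`. Unit speed on both sides forces `|ψ| = 1`, and continuity fixes
  -- the sign, so `φ` is a shift or a reflection.
  set ψ : ℝ → ℝ := fun s => component (β' t') (α' s) / component (β' t') (β' (φ s)) with hψ
  have hder : ∀ s ∈ J, HasDerivAt φ (ψ s) s := by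
    intro s hs
    have hnh : J ∈ 𝓝 s := Ioo_mem_nhds hs.1 hs.2
    exact hasDerivAt_of_comp_eq (hφc.continuousAt hnh) (hβ.hasDerivAt_component _ _)
      (hpos _ (hφ s hs).1).ne' (hα.hasDerivAt_component _ _) (by
        filter_upwards [hnh] with x hx
        rw [(hφ x hx).2])
  have hnorm : ∀ s ∈ J, |ψ s| = 1 := by
    intro s hs
    have hnh : J ∈ 𝓝 s := Ioo_mem_nhds hs.1 hs.2
    have h1 := (hβ.hasDerivAt (φ s)).scomp s (hder s hs)
    have h2 : HasDerivAt α (ψ s • β' (φ s)) s := by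
      refine h1.congr_of_eventuallyEq ?_
      filter_upwards [hnh] with x hx using (hφ x hx).2.symm
    have h3 := congrArg norm ((hα.hasDerivAt s).unique h2)
    rw [norm_smul, hα.norm_eq_one, hβ.norm_eq_one, mul_one, Real.norm_eq_abs] at h3
    exact h3.symm
  have hψc : ContinuousOn ψ J := by
    refine (hα.continuous_component _).continuousOn.div
      ((hβ.continuous_component _).comp_continuousOn hφc) fun s hs => (hpos _ (hφ s hs).1).ne'
  have htJ : t ∈ J := ⟨by linarith, by linarith⟩
  have hconst : ∀ s ∈ J, ψ s = ψ t := by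
    intro s hs
    have h1 := mul_pos_of_forall_ne_zero hψc ordConnected_Ioo (fun z hz h0 => by
      have := hnorm z hz
      rw [h0, abs_zero] at this
      exact zero_ne_one this) hs htJ
    rcases (abs_eq zero_le_one).1 (hnorm s hs) with h2 | h2 <;>
    rcases (abs_eq zero_le_one).1 (hnorm t htJ) with h3 | h3 <;>
    · rw [h2, h3] at h1 ⊢
      try norm_num at h1
  have hlin : ∀ s ∈ J, φ s - ψ t * s = φ t - ψ t * t := by
    intro s hs
    have hd : ∀ x ∈ J, HasDerivWithinAt (fun x => φ x - ψ t * x) 0 J x := by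
      intro x hx
      have h1 := (hder x hx).sub ((hasDerivAt_id x).const_mul (ψ t))
      rw [hconst x hx, mul_one, sub_self] at h1
      exact h1.hasDerivWithinAt
    have := (convex_Ioo (t - ε) (t + ε)).norm_image_sub_le_of_norm_hasDerivWithin_le hd
      (C := 0) (fun x _ => by simp) htJ hs
    rw [zero_mul] at this
    exact sub_eq_zero.1 (norm_le_zero_iff.1 this)
  have hev : ∀ᶠ s in 𝓝 (0 : ℝ), α (t + s) = β (t' + ψ t * s) := by
    filter_upwards [Ioo_mem_nhds (neg_lt_zero.2 hε) hε] with s hs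
    have hsJ : t + s ∈ J := ⟨by linarith [hs.1], by linarith [hs.2]⟩
    have h1 := hlin (t + s) hsJ
    rw [← (hφ _ hsJ).2]
    congr 1
    rw [hφt] at h1
    linarith
  rcases (abs_eq zero_le_one).1 (hnorm t htJ) with h1 | h1
  · left
    simpa only [h1, one_mul] using hev
  · right
    simpa only [h1, neg_one_mul, ← sub_eq_add_neg] using hev

lemma neg_param (h : IsUnitSpeed α α') : IsUnitSpeed (fun s => α (-s)) (fun s => -α' (-s)) := by
  refine ⟨fun s => ?_, (h.continuous_deriv.comp continuous_neg).neg, fun s => ?_⟩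
  · have h1 := (h.hasDerivAt (-s)).scomp s (hasDerivAt_neg s)
    rw [neg_one_smul] at h1
    exact h1
  · rw [norm_neg, h.norm_eq_one]

/-- Unit speed curves in a simple set with the same initial data agree. -/
lemma eq_shift (hα : IsUnitSpeed α α') (hαΓ : ∀ s, α s ∈ Γ) (hβ : IsUnitSpeed β β')
    (hβΓ : ∀ s, β s ∈ Γ) (hΓ : IsSimple Γ) {t t' : ℝ} (htt : α t = β t')
    (hdd : α' t = β' t') (s : ℝ) : α (t + s) = β (t' + s) := by
  set A : Set ℝ := {s | α (t + s) = β (t' + s) ∧ α' (t + s) = β' (t' + s)} with hA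
  have hclosed : IsClosed A :=
    (isClosed_eq (hα.continuous.comp (by fun_prop)) (hβ.continuous.comp (by fun_prop))).inter
      (isClosed_eq (hα.continuous_deriv.comp (by fun_prop))
        (hβ.continuous_deriv.comp (by fun_prop)))
  have hopen : IsOpen A := by
    rw [isOpen_iff_mem_nhds]
    rintro x ⟨hx, hx'⟩
    have hev : ∀ᶠ s in 𝓝 (0 : ℝ), α (t + x + s) = β (t' + x + s) := by
      rcases hα.eventually_eq_or hαΓ hβ hβΓ (hΓ _ (hβΓ _)) hx with h1 | h1
      · exact h1
      -- A reflection would reverse the velocity, but the velocities agree and are nonzero.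
      · exfalso
        have e1 := (hα.hasDerivAt (t + x + 0)).comp_const_add (t + x) 0
        have e2 := (hβ.hasDerivAt (t' + x - 0)).comp_const_sub (t' + x) 0
        have e3 := (e2.congr_of_eventuallyEq h1).unique e1
        rw [add_zero, sub_zero, hx'] at e3
        have e4 : β' (t' + x) = 0 := by
          have : (2 : ℂ) * β' (t' + x) = 0 := by linear_combination -e3
          simpa using this
        have e5 := hβ.norm_eq_one (t' + x)
        rw [e4, norm_zero] at e5
        exact zero_ne_one e5
    have htend : Filter.Tendsto (fun z => z - x) (𝓝 x) (𝓝 0) := by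
      have : ContinuousAt (fun z : ℝ => z - x) x := by fun_prop
      simpa [ContinuousAt] using this
    filter_upwards [htend.eventually hev.eventually_nhds] with z hz
    have hr : ∀ u, u + x + (z - x) = u + z := fun u => by ring
    have h0 := hz.self_of_nhds
    rw [hr, hr] at h0
    refine ⟨h0, ?_⟩
    have e1 := (hα.hasDerivAt (t + x + (z - x))).comp_const_add (t + x) (z - x)
    have e2 := (hβ.hasDerivAt (t' + x + (z - x))).comp_const_add (t' + x) (z - x)
    have e3 := (e2.congr_of_eventuallyEq hz).unique e1
    rw [hr, hr] at e3
    exact e3.symm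
  have huniv : A = univ := IsClopen.eq_univ ⟨hclosed, hopen⟩ ⟨0, by simpa [hA] using ⟨htt, hdd⟩⟩
  have : s ∈ A := by rw [huniv]; trivial
  exact this.1

/-- A unit speed parametrization of a simple set is injective up to periods. -/
lemma periodic_of_eq (hα : IsUnitSpeed α α') (hs : IsSimple (range α)) {t t' : ℝ}
    (htt : α t = α t') : Function.Periodic α (t' - t) := by
  rcases hα.eventually_eq_or mem_range_self hα mem_range_self (hs _ (mem_range_self t')) htt
    with h1 | h1
  · have e1 := (hα.hasDerivAt (t + 0)).comp_const_add t 0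
    have e2 := (hα.hasDerivAt (t' + 0)).comp_const_add t' 0
    have e3 := (e2.congr_of_eventuallyEq h1).unique e1
    rw [add_zero, add_zero] at e3
    intro s
    have := hα.eq_shift mem_range_self hα mem_range_self hs htt e3.symm (s - t)
    rw [add_sub_cancel] at this
    rw [this]
    congr 1
    ring
  · exfalso
    have e1 := (hα.hasDerivAt (t + 0)).comp_const_add t 0
    have e2 := (hα.hasDerivAt (t' - 0)).comp_const_sub t' 0
    have e3 := (e2.congr_of_eventuallyEq h1).unique e1
    rw [add_zero, sub_zero] at e3
    -- In the reflected case `α` agrees with its own reversal to first order at `t`, hence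
    -- everywhere.
    have hall := fun s => hα.eq_shift (β := fun s => α (-s)) (t := t) (t' := -t') mem_range_self
      hα.neg_param (fun s => mem_range_self (-s)) hs (by simpa using htt)
      (by simpa using e3.symm) s
    have hfun : (fun s => α (t + s)) = fun s => α (t' - s) := by
      funext s
      rw [hall s]
      congr 1
      ring
    -- At the midpoint of `t` and `t'` both sides have the same parameter, so the velocity there
    -- equals its own negative.
    set d := (t' - t) / 2 with hd
    have f1 := (hα.hasDerivAt (t + d)).comp_const_add t d
    have f2 := (hα.hasDerivAt (t' - d)).comp_const_sub t' d
    rw [← hfun] at f2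
    have f3 := f1.unique f2
    have f4 : t' - d = t + d := by rw [hd]; ring
    rw [f4] at f3
    have f5 : α' (t + d) = 0 := by
      have : (2 : ℂ) * α' (t + d) = 0 := by linear_combination f3
      simpa using this
    have f6 := hα.norm_eq_one (t + d)
    rw [f5, norm_zero] at f6
    exact zero_ne_one f6

/-- A symmetry of the oriented set sends the initial point and tangent to those at some parameter
`c`; by `eq_shift` it is then the shift by `c`. -/
lemma symIndex_eq (hα : IsUnitSpeed α α') (hs : IsSimple (range α)) :
    symIndex α = paramSymIndex α := by
  have hder : deriv α = α' := funext fun s => (hα.hasDerivAt s).deriv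
  unfold symIndex paramSymIndex
  rw [hder]
  congr 1
  ext g
  have hg : IsUnitSpeed (fun s => se2Act g (α s)) (fun s => (g.1 : ℂ) * α' s) :=
    ⟨fun s => ((hα.hasDerivAt s).const_mul (g.1 : ℂ)).add_const g.2,
      continuous_const.mul hα.continuous_deriv,
      fun s => by rw [norm_mul, hα.norm_eq_one, Circle.norm_coe, mul_one]⟩
  constructor
  · rintro ⟨h1, h2⟩
    have hmem : (se2Act g (α 0), (g.1 : ℂ) * α' 0) ∈ range fun s => (α s, α' s) := by
      rw [← h2]
      exact ⟨(α 0, α' 0), mem_range_self 0, rfl⟩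
    obtain ⟨c, hc⟩ := hmem
    refine ⟨c, fun s => ?_⟩
    have := hg.eq_shift (Γ := range α) (t := 0) (t' := c)
      (fun s => h1 ▸ mem_image_of_mem _ (mem_range_self s)) hα mem_range_self hs
      (congrArg Prod.fst hc).symm (congrArg Prod.snd hc).symm s
    rwa [zero_add, add_comm c] at this
  · rintro ⟨c, hc⟩
    have hd : ∀ s, (g.1 : ℂ) * α' s = α' (s + c) := by
      intro s
      have e1 := hg.hasDerivAt s
      have e2 := (hα.hasDerivAt (s + c)).comp_add_const s c
      rw [← funext hc] at e2
      exact e1.unique e2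
    have hsurj : Function.Surjective fun s : ℝ => s + c := fun s => ⟨s - c, by ring⟩
    constructor
    · rw [← range_comp]
      have : se2Act g ∘ α = α ∘ fun s => s + c := funext hc
      rw [this, hsurj.range_comp]
    · rw [← range_comp]
      have : (fun x : ℂ × ℂ => (se2Act g x.1, (g.1 : ℂ) * x.2)) ∘ (fun s => (α s, α' s)) =
          (fun s => (α s, α' s)) ∘ fun s => s + c := funext fun s => Prod.ext (hc s) (hd s)
      rw [this, hsurj.range_comp]

/-- Equal points differ by a period, so `α` is injective on `[0, L)` and counting points is counting
parameters. -/
lemma sigIndex_eq (hα : IsUnitSpeed α α') (hs : IsSimple (range α)) {L : ℝ} (hL : 0 < L)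
    (hper : Function.Periodic α L)
    (hmin : ∀ p, Function.Periodic α p → ∃ k : ℤ, p = k * L) :
    sigIndex α = paramSigIndex α L := by
  have hσper : Function.Periodic (signatureMap α) L := by
    have hd : ∀ {f : ℝ → ℂ}, Function.Periodic f L → Function.Periodic (deriv f) L := by
      intro f hf s
      rw [← deriv_comp_add_const, funext hf]
    have hd1 := hd hper
    have hd2 := hd hd1
    have hk : Function.Periodic (curvature α) L := fun s => by
      simp only [curvature, hd1 s, hd2 s]
    intro s
    have hk' : deriv (curvature α) (s + L) = deriv (curvature α) s := by
      rw [← deriv_comp_add_const, funext hk]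
    simp only [signatureMap, curvatureDot, hk s, hk', hd1 s]
  have hinj : InjOn α (Ico 0 L) := by
    intro x hx y hy hxy
    obtain ⟨k, hk⟩ := hmin _ (hα.periodic_of_eq hs hxy)
    have hk0 : k = 0 := by
      have h1 : (k : ℝ) * L < 1 * L := by linarith [hx.1, hy.2]
      have h2 : (-1 : ℝ) * L < k * L := by linarith [hx.2, hy.1]
      have h3 : k < 1 := by exact_mod_cast lt_of_mul_lt_mul_right h1 hL.le
      have h4 : -1 < k := by exact_mod_cast lt_of_mul_lt_mul_right h2 hL.le
      omega
    rw [hk0, Int.cast_zero, zero_mul] at hk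
    linarith
  unfold sigIndex paramSigIndex
  rw [iInf_range]
  congr 1
  funext t
  have himg : α '' {u | signatureMap α u = signatureMap α t} =
      α '' {u | u ∈ Ico 0 L ∧ signatureMap α u = signatureMap α t} := by
    apply Subset.antisymm
    · rintro _ ⟨u, hu, rfl⟩
      obtain ⟨v, hv, huv⟩ : ∃ v ∈ Ico 0 L, ∃ n : ℤ, v = u - n * L := by
        refine ⟨u - ⌊u / L⌋ * L, ⟨?_, ?_⟩, ⌊u / L⌋, rfl⟩
        · linarith [(le_div_iff₀ hL).1 (Int.floor_le (u / L))]
        · linarith [(div_lt_iff₀ hL).1 (Int.lt_floor_add_one (u / L))]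
      obtain ⟨n, rfl⟩ := huv
      refine ⟨u - n * L, ⟨hv, ?_⟩, hper.sub_int_mul_eq n⟩
      rw [hσper.sub_int_mul_eq n]
      exact hu
    · exact image_mono fun u hu => hu.2
  rw [himg, (hinj.mono fun u hu => hu.1).encard_image]

end IsUnitSpeed

/-! ### Assembly -/

lemma isSignaturePair_curvature {γ : ℝ → ℂ} {L : ℝ} (hγ : IsClosedCurve γ L)
    (hnd : IsNondegenerate γ) : IsSignaturePair (curvature γ) (curvatureDot γ) := by
  have h2 : ContDiff ℝ 2 (deriv γ) := by
    have h3 := hγ.contDiff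
    have : (3 : WithTop ℕ∞) = 2 + 1 := by norm_num
    rw [this, contDiff_succ_iff_deriv] at h3
    exact h3.2.2
  have h1 : ContDiff ℝ 1 (deriv (deriv γ)) := by
    have : (2 : WithTop ℕ∞) = 1 + 1 := by norm_num
    rw [this, contDiff_succ_iff_deriv] at h2
    exact h2.2.2
  have h2' : ContDiff ℝ 1 (deriv γ) := h2.of_le (by norm_num)
  have hκ : ContDiff ℝ 1 (curvature γ) := by
    have : curvature γ = fun t => (deriv γ t).re * (deriv (deriv γ) t).im -
        (deriv γ t).im * (deriv (deriv γ) t).re := by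
      funext t
      rw [curvature, hγ.unit_speed, one_pow, div_one]
    rw [this]
    exact ((Complex.reCLM.contDiff.comp h2').mul (Complex.imCLM.contDiff.comp h1)).sub
      ((Complex.imCLM.contDiff.comp h2').mul (Complex.reCLM.contDiff.comp h1))
  have hdot : curvatureDot γ = deriv (curvature γ) := by
    funext t
    rw [curvatureDot, hγ.unit_speed, div_one]
  have hc : Continuous (curvatureDot γ) := by
    rw [hdot]
    exact hκ.continuous_deriv le_rfl
  refine ⟨fun t => ?_, hc, fun t => ?_⟩
  · rw [hdot]
    exact (hκ.differentiable one_ne_zero t).hasDerivAt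
  · by_cases h0 : curvatureDot γ t = 0
    · obtain ⟨U, hU, hUV⟩ := hnd (γ t) ⟨t, h0, rfl⟩
      have hγd : HasDerivAt γ (deriv γ t) t :=
        (hγ.contDiff.differentiable (by norm_num) t).hasDerivAt
      have hd0 : deriv γ t ≠ 0 := by
        rw [← norm_ne_zero_iff, hγ.unit_speed]
        exact one_ne_zero
      -- Vertices are isolated as points of the plane. Since `γ' t ≠ 0`, the curve leaves `γ t` at
      -- once, so the zeros of `κ̇` are isolated as parameters as well.
      filter_upwards [hγd.eventually_ne (c := γ t) hd0,
        nhdsWithin_le_nhds (hγd.continuousAt hU)] with s hs hsU hs0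
      have : γ s ∈ curveVertices γ ∩ U := ⟨⟨s, hs0, rfl⟩, hsU⟩
      rw [hUV] at this
      exact hs this
    · exact nhdsWithin_le_nhds (hc.continuousAt.eventually_ne h0)

lemma iInf_encard_cyclicGet {α : Type*} (W : List α) (hW : W ≠ []) :
    ⨅ j : ℤ, {r : ℤ | 0 ≤ r ∧ r < W.length ∧ cyclicGet W hW r = cyclicGet W hW j}.encard =
      ⨅ E ∈ W, (multiplicity W E : ℕ∞) := by
  simp only [encard_cyclicGet_eq]
  apply le_antisymm
  · refine le_iInf₂ fun E hE => ?_
    obtain ⟨r, hr, rfl⟩ := List.mem_iff_getElem.1 hE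
    rw [← cyclicGet_natCast W hW hr]
    exact iInf_le (fun j : ℤ => (multiplicity W (cyclicGet W hW j) : ℕ∞)) r
  · refine le_iInf fun j => ?_
    obtain ⟨r, hr, -, h⟩ := exists_cyclicGet_eq W hW j
    rw [h]
    exact iInf₂_le W[r] (List.getElem_mem hr)

/-- The curve induced by a closed path `wᵐ` in the quiver of a signature pair. -/
theorem closedCurve_of_closedPath {κ κ' : ℝ → ℝ} (h : IsSignaturePair κ κ') {ξ : ℤ}
    {ω : QuiverEdge (range (sigPair κ κ')) → ℝ}
    (hω : ∀ E, ∃ a b, IsEdgeArc (sigPair κ κ') E a b ∧ ω E = ∫ s in a..b, κ s)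
    {w : List (QuiverEdge (range (sigPair κ κ')))} {m : ℕ} (hw : ¬ IsPeriodicWord w) (hm : 1 < m)
    (hW : IsClosedPath (sigPair κ κ') (wordPow w m)) (hgcd : IsCoprime (m : ℤ) ξ)
    {I : List (ℝ × ℝ)}
    (hI : List.Forall₂ (fun E p => IsEdgeArc (sigPair κ κ') E p.1 p.2) (wordPow w m) I)
    (hsum : ∑ᶠ E, (multiplicity (wordPow w m) E : ℝ) * ω E = 2 * Real.pi * ξ) :
    (∃ ℓ, totalLength I = m * ℓ ∧ IsSymmetricCurvature (reshuffle κ I) ℓ m ξ) ∧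
      ContDiff ℝ 1 (reshuffle κ I) ∧
      ⨅ ζ ∈ range (sigPair (reshuffle κ I) (deriv (reshuffle κ I))),
        {s | s ∈ Ico 0 (totalLength I) ∧
          sigPair (reshuffle κ I) (deriv (reshuffle κ I)) s = ζ}.encard =
        ⨅ E ∈ wordPow w m, (multiplicity (wordPow w m) E : ℕ∞) := by
  obtain ⟨hne, -⟩ := hW.2
  have hwne : w ≠ [] := by
    rintro rfl
    exact hne (by simp [wordPow])
  have hIne : I ≠ [] := by
    rintro rfl
    exact hne (List.forall₂_nil_right_iff.1 hI)
  have hc := isArcChain_reshuffle h hne hW hI hIne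
  have he := cyclicGet_periodic (wordPow w m) hne
  have hn : (0 : ℤ) < (wordPow w m).length := by
    exact_mod_cast List.length_pos_iff.2 hne
  have hew : cyclicGet (wordPow w m) hne = cyclicGet w hwne := cyclicGet_wordPow w hwne m hne
  have he0 : Function.Periodic (cyclicGet (wordPow w m) hne) w.length := by
    rw [hew]
    exact cyclicGet_periodic w hwne
  have hlen : breakpoint I (wordPow w m).length = totalLength I := by
    rw [hI.length_eq, breakpoint_length hIne]
  have hmul := hc.mul_period h he0
  have hT : totalLength I = m * breakpoint I w.length := by
    have := hmul m
    rw [← hlen, length_wordPow]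
    push_cast at this ⊢
    exact this
  obtain ⟨τ, hτc, hτd, hσ⟩ := hc.exists_derivative h hn he
  have hderiv : deriv (reshuffle κ I) = τ := funext fun s => (hτd s).deriv
  have hcd : ContDiff ℝ 1 (reshuffle κ I) := by
    rw [contDiff_one_iff_deriv, hderiv]
    exact ⟨fun s => (hτd s).differentiableAt, hτc⟩
  refine ⟨⟨breakpoint I w.length, hT, hcd.continuous, ?_, fun p => ⟨fun hp => ?_, ?_⟩, hm, hgcd, ?_⟩,
    hcd, ?_⟩
  · have h0 : (0 : ℤ) < w.length := by exact_mod_cast List.length_pos_iff.2 hwne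
    have := hc.strictMono h0
    rwa [hc.zero] at this
  -- A period of `κW` is one of its derivative, hence of the whole signature map, as `exists_period`
  -- requires.
  · have hp' : Function.Periodic (sigPair (reshuffle κ I) τ) p := by
      intro s
      refine Prod.ext (hp s) ?_
      change τ (s + p) = τ s
      rw [← hderiv, ← deriv_comp_add_const, funext hp]
    obtain ⟨d, hd, hper⟩ := hc.exists_period h hn he hσ hp'
    rw [hew] at hper
    obtain ⟨k, rfl⟩ := length_dvd_of_periodic w hwne hw hper
    refine ⟨k, ?_⟩
    rw [← hd, mul_comm, hmul]
  · rintro ⟨k, rfl⟩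
    rw [← hmul]
    exact hc.periodic_of_periodic h hn he (he0.int_mul k)
  · rw [← hT, ← hlen, tangentAngle, hc.integral_eq_sum hcd.continuous, ← hsum,
      finsum_multiplicity_mul, Finset.sum_range, ← Fin.sum_univ_fun_getElem]
    refine Finset.sum_congr rfl fun r _ => ?_
    obtain ⟨a, b, hab, hx⟩ := hω (wordPow w m)[r.1]
    have harc := hc.arc (r : ℕ)
    rw [cyclicGet_natCast _ hne r.2] at harc
    rw [hx]
    exact harc.integral_eq h hab
  · rw [hderiv, ← hlen, hc.iInf_encard_fiber h hn he hσ, iInf_encard_cyclicGet]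

end SigCurve

theorem mainTheorem7
    (γ : ℝ → ℂ) (L : ℝ) (hγ : IsClosedCurve γ L) (hnd : IsNondegenerate γ)
    (ξ : ℤ) (hξ : HasTurningNumber γ L ξ)
    (hQ : (selfIntersections (Set.range (signatureMap γ))).Nonempty)
    (hQfin : (selfIntersections (Set.range (signatureMap γ))).Finite)
    (ω : QuiverEdge (Set.range (signatureMap γ)) → ℝ) (hω : ∀ E, IsWeight γ E (ω E))
    (w W : List (QuiverEdge (Set.range (signatureMap γ)))) (m : ℕ)
    (hw : ¬ IsPeriodicWord w) (hm : 1 < m) (hWw : W = wordPow w m)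
    (hW : IsClosedPath (signatureMap γ) W)
    (hgcd : IsCoprime (m : ℤ) ξ)
    (I : List (ℝ × ℝ))
    (hI : List.Forall₂ (fun E p => IsEdgeArc (signatureMap γ) E p.1 p.2) W I)
    (hsum : ∑ᶠ E, (multiplicity W E : ℝ) * ω E = 2 * Real.pi * ξ)
    (κW : ℝ → ℝ) (hκW : κW = reshuffle (curvature γ) I)
    (γW : ℝ → ℂ) (hγW : γW = curveOfCurvature κW) :
    IsClosedCurve γW (totalLength I) ∧
    (∀ s, curvature γW s = κW s) ∧
    HasTurningNumber γW (totalLength I) ξ ∧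
    paramSymIndex γW = m ∧
    paramSigIndex γW (totalLength I) = ⨅ E ∈ W, (multiplicity W E : ℕ∞) ∧
    (IsSimple (Set.range γW) →
      symIndex γW = m ∧ sigIndex γW = ⨅ E ∈ W, (multiplicity W E : ℕ∞)) := by
  subst hWw hκW hγW
  -- By definition `signatureMap γ` is `sigPair (curvature γ) (curvatureDot γ)`, so the data of the
  -- path apply unchanged.
  obtain ⟨⟨ℓ, hT, hsym⟩, hcd, hsig⟩ :=
    closedCurve_of_closedPath (isSignaturePair_curvature hγ hnd) hω hw hm hW hgcd hI hsum
  have hc := hsym.continuous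
  have hcurv := curvature_curveOfCurvature hc
  have hu : IsUnitSpeed (curveOfCurvature (reshuffle (curvature γ) I))
      (unitTangent (reshuffle (curvature γ) I)) :=
    ⟨hasDerivAt_curveOfCurvature hc, continuous_unitTangent hc, norm_unitTangent⟩
  have hmap : signatureMap (curveOfCurvature (reshuffle (curvature γ) I)) =
      sigPair (reshuffle (curvature γ) I) (deriv (reshuffle (curvature γ) I)) := by
    funext s
    simp only [signatureMap, curvatureDot, sigPair, hcurv, deriv_curveOfCurvature hc,
      norm_unitTangent, div_one]
  have hindex : paramSigIndex (curveOfCurvature (reshuffle (curvature γ) I)) (totalLength I) =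
      ⨅ E ∈ wordPow w m, (multiplicity (wordPow w m) E : ℕ∞) := by
    rw [paramSigIndex, hmap]
    exact hsig
  refine ⟨?_, fun s => congrFun hcurv s, ?_, hsym.paramSymIndex_eq, hindex, fun hs => ⟨?_, ?_⟩⟩
  · rw [hT]
    exact hsym.isClosedCurve hcd
  · refine hasTurningNumber_curveOfCurvature hc ?_
    rw [hT]
    exact hsym.angle
  · rw [hu.symIndex_eq hs, hsym.paramSymIndex_eq]
  · rw [← hindex, hT]
    exact hu.sigIndex_eq hs hsym.period_pos hsym.curve_periodic
      fun p hp => hsym.exists_of_curve_periodic hp
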